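/- Let $X$ be a countable set, $\phi\colon X\to X$, $(W,\mathscr A,\varrho)$ a $\sigma$-finite measure space, and let $\lambda_x\colon W\to\mathbb C$, $x\in X$, be $\mathscr A$-measurable functions. Let $M_{\lambda_x}$ be the operator of multiplication by $\lambda_x$ in $L^2(\varrho)$ with its maximal domain, and let $C_{\phi,\Lambda}$ be the operator in $\ell^2(\{\mathcal H_x\}_{x\in X})$, $\mathcal H_x=L^2(\varrho)$, given by $(C_{\phi,\Lambda}\boldsymbol f)_x=\lambda_x f_{\phi(x)}$ on the domain of all $\boldsymbol f$ such that $\lambda_x f_{\phi(x)}\in L^2(\varrho)$ for every $x$ and $\sum_{x\in X}\|\lambda_x f_{\phi(x)}\|^2<\infty$. Assume that $C_{\phi,\Lambda}$ is everywhere defined and bounded, and that it is subnormal, i.e. it has a normal (closed, densely defined, possibly unbounded) extension in some Hilbert space into which $\ell^2(\{\mathcal H_x\})$ is isometrically embedded. Then there is a family $\{\vartheta_x^w\colon x\in X,\,w\in W\}$ of Borel probability measures on $\mathbb R_+=[0,\infty)$ such that: (i) for all $x\in X$ and all Borel $\sigma\subseteq\mathbb R_+$ the map $w\mapsto\vartheta_x^w(\sigma)$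 is $\mathscr A$-measurable; (ii) $|\lambda_x(w)|^2\vartheta_x^w\ll\vartheta_{\phi(x)}^w$ for all $x\in X$ and $w\in W$; (iii) let $\widehat\varrho_x$ be the measure on $W\times\mathbb R_+$ with $\widehat\varrho_x(A\times\sigma)=\int_A\vartheta_x^w(\sigma)\,d\varrho(w)$, let $\widehat\lambda_x(w,s)=\lambda_x(w)$, and let $$\mathsf G_x=\sum_{y\in\phi^{-1}(\{x\})}\frac{d\,|\widehat\lambda_y|^2\widehat\varrho_y}{d\,\widehat\varrho_x}$$ (with $\mathsf G_x=0$ if $x\notin\phi(X)$). The versions of these Radon-Nikodym derivatives can be chosen so that $\mathsf G_x=\mathsf G_{\phi(x)}$ a.e. $[\widehat\varrho_x]$ for every $x\in X$. Moreover, for every choice of the versions of the derivatives and every $x\in X$, $\mathsf G_x<\infty$ a.e. $[\widehat\varrho_x]$ and $\lambda_x\mathsf G_x=\lambda_x\mathsf G_{\phi(x)}$ a.e. $[\widehat\varrho_x]$. (If these conditions hold for some family $\{\vartheta_x^w\}$ with (i) and (ii), then $C_{\phi,\Lambda}$ is known to be subnormal; so in the bounded case they are also necessary.) -/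

import Mathlib

open MeasureTheory ProbabilityTheory
open scoped ENNReal NNReal

noncomputable section

namespace OWCO

universe u v

/-! ### Unbounded operators in Hilbert spaces -/

section Operators

variable {E : Type u} [NormedAddCommGroup E] [InnerProductSpace ℂ E]

/-- The product `B A` of two (possibly unbounded) operators, with its natural domain
`{f ∈ dom A : A f ∈ dom B}`. -/
def prodOp (B A : E →ₗ.[ℂ] E) : E →ₗ.[ℂ] E where
  domain :=
    { carrier := {f | ∃ hf : f ∈ A.domain, A ⟨f, hf⟩ ∈ B.domain}
      add_mem' := by
        rintro f g ⟨hf, hf'⟩ ⟨hg, hg'⟩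
        refine ⟨A.domain.add_mem hf hg, ?_⟩
        have : A ⟨f + g, A.domain.add_mem hf hg⟩ = A ⟨f, hf⟩ + A ⟨g, hg⟩ :=
          A.map_add ⟨f, hf⟩ ⟨g, hg⟩
        rw [this]
        exact B.domain.add_mem hf' hg'
      zero_mem' := by
        refine ⟨A.domain.zero_mem, ?_⟩
        have : A ⟨0, A.domain.zero_mem⟩ = 0 := A.map_zero
        rw [this]
        exact B.domain.zero_mem
      smul_mem' := by
        rintro c f ⟨hf, hf'⟩
        refine ⟨A.domain.smul_mem c hf, ?_⟩
        have : A ⟨c • f, A.domain.smul_mem c hf⟩ = c • A ⟨f, hf⟩ := A.map_smul c ⟨f, hf⟩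
        rw [this]
        exact B.domain.smul_mem c hf' }
  toFun :=
    { toFun := fun f => B ⟨A ⟨f.1, f.2.choose⟩, f.2.choose_spec⟩
      map_add' := by
        rintro ⟨f, hf⟩ ⟨g, hg⟩
        rw [← B.map_add]
        congr 1
        apply Subtype.ext
        exact A.map_add ⟨f, hf.choose⟩ ⟨g, hg.choose⟩
      map_smul' := by
        rintro c ⟨f, hf⟩
        rw [RingHom.id_apply, ← B.map_smul]
        congr 1
        apply Subtype.ext
        exact A.map_smul c ⟨f, hf.choose⟩ }

/-- `A ∈ B(E)`: the operator `A` is defined on the whole space and is bounded. -/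
def IsBoundedOp (A : E →ₗ.[ℂ] E) : Prop :=
  A.domain = ⊤ ∧ ∃ c : ℝ, ∀ f : A.domain, ‖A f‖ ≤ c * ‖(f : E)‖

/-- A (possibly unbounded) normal operator: closed, densely defined, and `N* N = N N*`
(equality of domains included). -/
def IsNormalOp [CompleteSpace E] (N : E →ₗ.[ℂ] E) : Prop :=
  N.IsClosed ∧ Dense (N.domain : Set E) ∧ prodOp N.adjoint N = prodOp N N.adjoint

/-- A subnormal operator: densely defined, and having a normal extension in some Hilbert space `K`
which contains `E` by way of an isometric embedding `J`. -/
def IsSubnormalOp (S : E →ₗ.[ℂ] E) : Prop :=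
  Dense (S.domain : Set E) ∧
    ∃ (K : Type v) (_ : NormedAddCommGroup K) (_ : InnerProductSpace ℂ K) (_ : CompleteSpace K)
      (J : E →ₗᵢ[ℂ] K) (N : K →ₗ.[ℂ] K),
      IsNormalOp N ∧
        ∀ f : S.domain, ∃ hf : J (f : E) ∈ N.domain, N ⟨J (f : E), hf⟩ = J (S f)

end Operators

/-! ### Operator-weighted composition operators -/

/-- The operator-weighted composition operator `C_{φ,Λ}` in `ℓ²(H)`, where `H` is a family of
Hilbert spaces and `Λ x` is an operator from `H (φ x)` to `H x`. Its domain consists of all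
`f ∈ ℓ²(H)` such that `f (φ x) ∈ dom (Λ x)` for every `x` and `∑ ‖Λ x (f (φ x))‖² < ∞`, and
`(C_{φ,Λ} f) x = Λ x (f (φ x))`. -/
def opWeightedComp {X : Type*} {H : X → Type*} [∀ x, NormedAddCommGroup (H x)]
    [∀ x, InnerProductSpace ℂ (H x)] (φ : X → X) (Λ : ∀ x, H (φ x) →ₗ.[ℂ] H x) :
    lp H 2 →ₗ.[ℂ] lp H 2 where
  domain :=
    { carrier := {f | ∃ hf : ∀ x, f (φ x) ∈ (Λ x).domain,
        Memℓp (fun x => Λ x ⟨f (φ x), hf x⟩) 2}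
      add_mem' := by
        rintro f g ⟨hf, hf'⟩ ⟨hg, hg'⟩
        refine ⟨fun x => (Λ x).domain.add_mem (hf x) (hg x), ?_⟩
        convert hf'.add hg' using 1
        funext x
        exact (Λ x).map_add ⟨f (φ x), hf x⟩ ⟨g (φ x), hg x⟩
      zero_mem' := by
        refine ⟨fun x => (Λ x).domain.zero_mem, ?_⟩
        convert zero_memℓp (E := H) (p := 2) using 1
        funext x
        exact (Λ x).map_zero
      smul_mem' := by
        rintro c f ⟨hf, hf'⟩
        refine ⟨fun x => (Λ x).domain.smul_mem c (hf x), ?_⟩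
        convert hf'.const_smul c using 1
        funext x
        exact (Λ x).map_smul c ⟨f (φ x), hf x⟩ }
  toFun :=
    { toFun := fun f => ⟨fun x => Λ x ⟨f.1 (φ x), f.2.choose x⟩, f.2.choose_spec⟩
      map_add' := by
        rintro ⟨f, hf⟩ ⟨g, hg⟩
        ext1
        funext x
        exact (Λ x).map_add ⟨f (φ x), hf.choose x⟩ ⟨g (φ x), hg.choose x⟩
      map_smul' := by
        rintro c ⟨f, hf⟩
        ext1
        funext x
        exact (Λ x).map_smul c ⟨f (φ x), hf.choose x⟩ }

/-- The operator `M_g` of multiplication by `g` in `L²(ϱ)`, with its maximal domain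
`{f ∈ L²(ϱ) : g f ∈ L²(ϱ)}`. -/
def mulOp {W : Type*} [MeasurableSpace W] (ϱ : Measure W) (g : W → ℂ) :
    Lp ℂ 2 ϱ →ₗ.[ℂ] Lp ℂ 2 ϱ where
  domain :=
    { carrier := {f | MemLp (fun w => g w * f w) 2 ϱ}
      add_mem' := by
        intro a b ha hb
        refine (memLp_congr_ae ?_).mp (MemLp.add ha hb)
        filter_upwards [Lp.coeFn_add a b] with w hw
        simp only [Pi.add_apply, hw, mul_add]
      zero_mem' := by
        refine (memLp_congr_ae ?_).mp (MemLp.zero (p := 2) (μ := ϱ) (ε := ℂ))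
        filter_upwards [Lp.coeFn_zero ℂ 2 ϱ] with w hw
        exact (mul_eq_zero_of_right (g w) hw).symm
      smul_mem' := by
        intro c a ha
        refine (memLp_congr_ae ?_).mp (MemLp.const_smul ha c)
        filter_upwards [Lp.coeFn_smul c a] with w hw
        simp only [Pi.smul_apply, hw, smul_eq_mul]
        ring }
  toFun :=
    { toFun := fun f => MemLp.toLp (fun w => g w * (f : Lp ℂ 2 ϱ) w) f.2
      map_add' := by
        rintro ⟨a, ha⟩ ⟨b, hb⟩
        rw [← MemLp.toLp_add, MemLp.toLp_eq_toLp_iff]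
        filter_upwards [Lp.coeFn_add a b] with w hw
        simp only [Pi.add_apply, AddMemClass.mk_add_mk, hw, mul_add]
      map_smul' := by
        rintro c ⟨a, ha⟩
        rw [RingHom.id_apply, ← MemLp.toLp_const_smul, MemLp.toLp_eq_toLp_iff]
        filter_upwards [Lp.coeFn_smul c a] with w hw
        simp only [SetLike.mk_smul_mk, Pi.smul_apply, hw, smul_eq_mul]
        ring }

/-- The operator `C_{φ,Λ}` in `ℓ²` of copies of `L²(ϱ)` whose weights are the multiplication
operators `M_{lam x}`. -/
abbrev mulWeightedComp {X W : Type*} [MeasurableSpace W] (ϱ : Measure W) (φ : X → X)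
    (lam : X → W → ℂ) :
    lp (fun _ : X => Lp ℂ 2 ϱ) 2 →ₗ.[ℂ] lp (fun _ : X => Lp ℂ 2 ϱ) 2 :=
  opWeightedComp φ (fun x => mulOp ϱ (lam x))

/-! ### The measures built from a family of probability measures -/

section Measures

variable {X : Type u} {W : Type v} [MeasurableSpace W]

/-- The measure `ϱ̂_x` on `W × ℝ₊`,
`ϱ̂_x (A × σ) = ∫_W ∫_{ℝ₊} χ_{A × σ}(w, s) dϑ_x^w(s) dϱ(w)`. -/
def hatMeasure (ϱ : Measure W) (ϑ : X → Kernel W ℝ≥0) (x : X) : Measure (W × ℝ≥0) :=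
  ϱ ⊗ₘ ϑ x

/-- The measure `|λ̂_x|² ϱ̂_x` on `W × ℝ₊`, where `λ̂_x (w, s) = lam x w`. -/
def hatWeightedMeasure (ϱ : Measure W) (lam : X → W → ℂ) (ϑ : X → Kernel W ℝ≥0) (x : X) :
    Measure (W × ℝ≥0) :=
  (hatMeasure ϱ ϑ x).withDensity (fun p => ‖lam x p.1‖ₑ ^ 2)

/-- `h` is a family of versions of the Radon-Nikodym derivatives
`h y = d(|λ̂_y|² ϱ̂_y) / dϱ̂_{φ(y)}`, `y ∈ X`. -/
def IsDerivFamily (ϱ : Measure W) (φ : X → X) (lam : X → W → ℂ) (ϑ : X → Kernel W ℝ≥0)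
    (h : X → W × ℝ≥0 → ℝ≥0∞) : Prop :=
  ∀ y, Measurable (h y) ∧
    hatWeightedMeasure ϱ lam ϑ y = (hatMeasure ϱ ϑ (φ y)).withDensity (h y)

/-- The function `G_x (w, s) = ∑_{y ∈ φ⁻¹({x})} h y (w, s)`; it is `0` if `x ∉ φ(X)`. -/
def G (φ : X → X) (h : X → W × ℝ≥0 → ℝ≥0∞) (x : X) (p : W × ℝ≥0) : ℝ≥0∞ :=
  ∑' y : φ ⁻¹' {x}, h y p

end Measures

end OWCO

end

/-!
Write `ϑ x w` for a measure on `ℝ₊` with `n`-th moment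
`orbitWeight φ lam n x w = ∑ |λ_y λ_{φ(y)} ⋯ λ_{φ^{n-1}(y)}|² (w)`, the sum running over
`y ∈ φ^{-n}({x})`. The whole result follows from the existence, for almost every `w`, of such
measures with support in a common compact interval. Indeed the recursion for the weights says that
the finite measures `t ϑ_x^w (dt)` and `∑_{y ∈ φ⁻¹({x})} |λ_y(w)|² ϑ_y^w (dt)` have the same moments,
so they are equal (`FibreIdentity`, `withDensity_eq_sum_of_moments`). Hence
`|λ_x|² ϑ_x^w ≪ ϑ_{φ(x)}^w`, and after integration over `w`
(`withDensity_hatMeasure_eq_sum`) every version of `G_x` equals `(w, t) ↦ t` almost everywhere with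
respect to `ϱ̂_x` (`IsDerivFamily.G_ae_eq`). As this function does not depend on `x`, the
invariance of `G` follows: where `λ_x ≠ 0` it holds for all versions, since
`|λ̂_x|² ϱ̂_x ≪ ϱ̂_{φ(x)}`; where `λ_x = 0` the measure `ϱ̂_x` may charge null sets of `ϱ̂_{φ(x)}`, and the
versions have to be corrected so that `G_{φ(x)} (w, t) = t` everywhere (`exists_isDerivFamily_G_eq`).

The weights are the densities of `f ↦ ‖C^n f‖²`, where `C = C_{φ,Λ}` (`enorm_iterate_sq`). If `N` is
a normal extension of `C`, then `dom N ⊆ dom N*` (von Neumann's theorem that `dom N*N` is a core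
of `N`), so that all the vectors `N*^i N^n f` exist, and `‖C^{i+j} f‖² = ⟪N*^i N^i f, N*^j N^j f⟫`
(`IsNormalOp.exists_gram`). The Riesz functional of the sequence `‖C^n f‖²` is therefore nonnegative
on `p²`, and in the same way on `X p²`. Together with the geometric growth of the sequence this gives
Hausdorff's condition of complete monotonicity (`riesz_hausdorff_nonneg`), which is linear in the
sequence and so passes to the densities almost everywhere (`ae_riesz_orbitWeight_nonneg`). The
Hausdorff moment problem is solved by weak compactness from the Bernstein polynomials
(`exists_probabilityMeasure_moments`), and the measurability of the solution in `w` follows from that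
of its moments (`measurable_of_moments`).
-/

namespace OWCO

open Polynomial Filter Topology unitInterval

/-! ### Riesz functionals and complete monotonicity -/

/-- The Riesz functional of a real sequence `a`: the linear functional on `ℝ[X]` which sends
`X ^ n` to `a n`. -/
noncomputable def riesz (a : ℕ → ℝ) : ℝ[X] →ₗ[ℝ] ℝ :=
  Polynomial.lsum fun n => a n • LinearMap.id

lemma riesz_apply (a : ℕ → ℝ) (p : ℝ[X]) : riesz a p = p.sum fun n c => a n * c := by
  simp [riesz, Polynomial.lsum_apply]

@[simp] lemma riesz_X_pow (a : ℕ → ℝ) (n : ℕ) : riesz a (X ^ n) = a n := by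
  rw [riesz_apply, X_pow_eq_monomial, sum_monomial_index] <;> simp

lemma riesz_eq_sum (a : ℕ → ℝ) (p : ℝ[X]) :
    riesz a p = ∑ n ∈ p.support, p.coeff n * a n := by
  rw [riesz_apply, Polynomial.sum_def]
  exact Finset.sum_congr rfl fun _ _ => mul_comm _ _

/-- If `a (i + j + d)` is a Gram matrix, the Riesz functional of `a` is nonnegative on `X ^ d` times
squares: its value at `X ^ d * p ^ 2` is `‖∑ pᵢ vᵢ‖²`. -/
lemma riesz_sq_nonneg {K : Type*} [NormedAddCommGroup K] [InnerProductSpace ℂ K] (a : ℕ → ℝ)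
    (d : ℕ) (v : ℕ → K) (h : ∀ i j, (inner ℂ (v i) (v j)).re = a (i + j + d)) (p : ℝ[X]) :
    0 ≤ riesz a (X ^ d * p ^ 2) := by
  have key : riesz a (X ^ d * p ^ 2) =
      (inner ℂ (∑ i ∈ p.support, (p.coeff i : ℂ) • v i)
        (∑ i ∈ p.support, (p.coeff i : ℂ) • v i)).re := by
    have hp : X ^ d * p ^ 2 = ∑ i ∈ p.support, ∑ j ∈ p.support,
        (p.coeff i * p.coeff j) • (X ^ (i + j + d) : ℝ[X]) := by
      conv_lhs => rw [sq, p.as_sum_support_C_mul_X_pow, Finset.sum_mul_sum, Finset.mul_sum]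
      refine Finset.sum_congr rfl fun i _ => ?_
      rw [Finset.mul_sum]
      refine Finset.sum_congr rfl fun j _ => ?_
      rw [smul_eq_C_mul, C_mul]
      ring
    rw [hp, sum_inner, map_sum, Complex.re_sum]
    refine Finset.sum_congr rfl fun i _ => ?_
    rw [inner_sum, map_sum, Complex.re_sum]
    refine Finset.sum_congr rfl fun j _ => ?_
    rw [map_smul, riesz_X_pow, inner_smul_left, inner_smul_right, Complex.conj_ofReal,
      Complex.re_ofReal_mul, Complex.re_ofReal_mul, h, smul_eq_mul]
    ring
  rw [key]
  exact inner_self_nonneg (𝕜 := ℂ)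

/-- A bounded log-convex nonnegative sequence is nonincreasing. -/
lemma le_of_logConvex_of_bounded (b : ℕ → ℝ) (hb : ∀ n, 0 ≤ b n)
    (hc : ∀ n, b (n + 1) ^ 2 ≤ b n * b (n + 2)) (B : ℝ) (hB : ∀ n, b n ≤ B) (n : ℕ) :
    b (n + 1) ≤ b n := by
  by_contra! hlt
  have h0 : 0 < b n := by
    refine lt_of_le_of_ne (hb n) fun h => ?_
    have := hc n
    rw [← h] at this hlt
    nlinarith
  -- the ratio of consecutive terms is nondecreasing, so the growth would be geometric
  set r := b (n + 1) / b n with hr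
  have hr1 : 1 < r := (one_lt_div h0).2 hlt
  have hstep : ∀ k, 0 < b (n + k) ∧ r * b (n + k) ≤ b (n + k + 1) := by
    intro k
    induction k with
    | zero => exact ⟨h0, by rw [hr]; simp [h0.ne']⟩
    | succ k ih =>
      obtain ⟨hp, hi⟩ := ih
      have hp' : 0 < b (n + k + 1) := lt_of_lt_of_le (by positivity) hi
      refine ⟨hp', ?_⟩
      have h2 := hc (n + k)
      have : r * b (n + k + 1) * b (n + k) ≤ b (n + k + 2) * b (n + k) := by nlinarith
      exact le_of_mul_le_mul_right this hp
  have hgeo : ∀ k, r ^ k * b n ≤ b (n + k) := by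
    intro k
    induction k with
    | zero => simp
    | succ k ih =>
      calc r ^ (k + 1) * b n = r * (r ^ k * b n) := by ring
        _ ≤ r * b (n + k) := by gcongr
        _ ≤ _ := (hstep k).2
  obtain ⟨k, hk⟩ := pow_unbounded_of_one_lt (B / b n) hr1
  rw [div_lt_iff₀ h0] at hk
  linarith [hgeo k, hB (n + k)]

/-- For a bounded sequence, positivity on squares and on `X` times squares gives Hausdorff's
condition of complete monotonicity. -/
lemma riesz_hausdorff_nonneg (a : ℕ → ℝ) (h0 : ∀ p : ℝ[X], 0 ≤ riesz a (p ^ 2))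
    (h1 : ∀ p : ℝ[X], 0 ≤ riesz a (X * p ^ 2)) (B : ℝ) (hB : ∀ n, |a n| ≤ B) (k l : ℕ) :
    0 ≤ riesz a (X ^ k * (1 - X) ^ l) := by
  have hpos : ∀ (n : ℕ) (q : ℝ[X]), 0 ≤ riesz a (X ^ n * q ^ 2) := by
    intro n q
    obtain ⟨m, rfl | rfl⟩ := n.even_or_odd'
    · convert h0 (X ^ m * q) using 2; ring
    · convert h1 (X ^ m * q) using 2; ring
  have hmono : ∀ (n : ℕ) (q : ℝ[X]), riesz a (X ^ (n + 1) * q ^ 2) ≤ riesz a (X ^ n * q ^ 2) := by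
    intro n q
    refine le_of_logConvex_of_bounded (fun n => riesz a (X ^ n * q ^ 2)) (fun n => hpos n q) ?_
      (∑ i ∈ (q ^ 2).support, |(q ^ 2).coeff i| * B) ?_ n
    · intro n
      have hq : ∀ s : ℝ, 0 ≤ riesz a (X ^ (n + 2) * q ^ 2) * (s * s) +
          (2 * riesz a (X ^ (n + 1) * q ^ 2)) * s + riesz a (X ^ n * q ^ 2) := by
        intro s
        have : X ^ n * ((1 + C s * X) * q) ^ 2 = (s * s) • (X ^ (n + 2) * q ^ 2) +
            (2 * s) • (X ^ (n + 1) * q ^ 2) + X ^ n * q ^ 2 := by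
          simp only [smul_eq_C_mul, C_mul, map_ofNat]
          ring
        have h := hpos n ((1 + C s * X) * q)
        rw [this, map_add, map_add, map_smul, map_smul, smul_eq_mul, smul_eq_mul] at h
        linarith
      have := discrim_le_zero hq
      rw [discrim] at this
      nlinarith
    · intro n
      have : X ^ n * q ^ 2 = ∑ i ∈ (q ^ 2).support, (q ^ 2).coeff i • (X ^ (n + i) : ℝ[X]) := by
        conv_lhs => rw [(q ^ 2).as_sum_support_C_mul_X_pow, Finset.mul_sum]
        refine Finset.sum_congr rfl fun i _ => ?_
        rw [smul_eq_C_mul]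
        ring
      rw [this, map_sum]
      refine Finset.sum_le_sum fun i _ => ?_
      rw [map_smul, riesz_X_pow, smul_eq_mul]
      refine (le_abs_self _).trans ?_
      rw [abs_mul]
      exact mul_le_mul_of_nonneg_left (hB _) (abs_nonneg _)
  obtain ⟨m, rfl | rfl⟩ := l.even_or_odd'
  · rw [mul_comm 2 m, pow_mul]
    exact hpos k _
  · have : X ^ k * (1 - X) ^ (2 * m + 1) =
        X ^ k * ((1 - X) ^ m) ^ 2 - X ^ (k + 1) * ((1 - X : ℝ[X]) ^ m) ^ 2 := by ring
    rw [this, map_sub]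
    exact sub_nonneg.2 (hmono _ _)

/-! ### The Hausdorff moment problem -/

/-- The weight which `riesz a` gives to the `k`-th Bernstein polynomial of degree `n`. -/
noncomputable def bernWeight (a : ℕ → ℝ) (n k : ℕ) : ℝ :=
  riesz a (n.choose k • (X ^ k * (1 - X) ^ (n - k)))

/-- Expansion of a monomial in Bernstein polynomials: in degree `n` the coefficients of `X ^ d` are
ratios of falling factorials. -/
lemma sum_descFactorial_smul_bernstein {n d : ℕ} (hd : d ≤ n) :
    ∑ k ∈ Finset.range (n + 1),
      (k.descFactorial d : ℝ) • (n.choose k • (X ^ k * (1 - X) ^ (n - k) : ℝ[X])) =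
      (n.descFactorial d : ℝ) • (X ^ d : ℝ[X]) := by
  obtain ⟨m, rfl⟩ := Nat.exists_eq_add_of_le hd
  rw [add_assoc, Finset.sum_range_add]
  rw [Finset.sum_eq_zero fun k hk => by
    rw [Nat.descFactorial_eq_zero_iff_lt.2 (Finset.mem_range.1 hk)]; simp, zero_add]
  have h1 : (X ^ d : ℝ[X]) = X ^ d * (X + (1 - X)) ^ m := by simp
  rw [h1, add_pow, Finset.mul_sum, Finset.smul_sum]
  refine Finset.sum_congr rfl fun j hj => ?_
  have hj' : j ≤ m := Nat.lt_succ_iff.1 (Finset.mem_range.1 hj)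
  have hc : (d + m).choose (d + j) * (d + j).descFactorial d =
      (d + m).descFactorial d * m.choose j := by
    have := Nat.choose_mul (n := d + m) (k := d + j) (s := d) (by omega)
    simp only [Nat.add_sub_cancel_left] at this
    rw [Nat.descFactorial_eq_factorial_mul_choose, Nat.descFactorial_eq_factorial_mul_choose]
    calc _ = d.factorial * ((d + m).choose (d + j) * (d + j).choose d) := by ring
      _ = _ := by rw [this]; ring
  have hc' : (((d + m).choose (d + j) : ℕ) : ℝ[X]) * (((d + j).descFactorial d : ℕ) : ℝ[X]) =
      (((d + m).descFactorial d : ℕ) : ℝ[X]) * ((m.choose j : ℕ) : ℝ[X]) := by exact_mod_cast hc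
  rw [show d + m - (d + j) = m - j by omega, smul_eq_C_mul, smul_eq_C_mul, nsmul_eq_mul,
    map_natCast, map_natCast, pow_add]
  linear_combination (X ^ d * X ^ j * (1 - X) ^ (m - j)) * hc'

/-- The coefficients of `X ^ d` in the Bernstein polynomials of degree `n` are within `O(1 / n)` of
the values of `t ^ d` at the nodes `k / n`. The bound `D` on `d` is kept fixed so that the error
is additive in the induction on `d`. -/
lemma abs_descFactorial_div_sub_le {n k : ℕ} (hk : k ≤ n) (D d : ℕ) (hdD : d ≤ D) (hD : D ≤ n) :
    |(k.descFactorial d : ℝ) / n.descFactorial d - ((k : ℝ) / n) ^ d| ≤ d * (D / n) := by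
  have hkn : (k : ℝ) / n ≤ 1 := div_le_one_of_le₀ (by exact_mod_cast hk) (by positivity)
  have hkn0 : (0 : ℝ) ≤ (k : ℝ) / n := by positivity
  induction d with
  | zero => simp
  | succ d ih =>
    have ih := ih (by omega)
    set x := (k.descFactorial d : ℝ) / n.descFactorial d
    set y := (k : ℝ) / n with hy
    set z := ((k - d : ℕ) : ℝ) / ((n - d : ℕ) : ℝ) with hz
    have hn : (0 : ℝ) < n := by exact_mod_cast (by omega : 0 < n)
    have hnd : (0 : ℝ) < ((n - d : ℕ) : ℝ) := by exact_mod_cast (by omega : 0 < n - d)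
    have hz0 : 0 ≤ z := by positivity
    have hz1 : z ≤ 1 := div_le_one_of_le₀ (by exact_mod_cast (by omega)) (by positivity)
    have hzy : |z - y| ≤ D / n := by
      have hdn : (d : ℝ) ≤ D := by exact_mod_cast (by omega)
      rw [hz, hy, abs_le]
      rcases le_total d k with h | h
      · have hkn' : (k : ℝ) ≤ n := by exact_mod_cast hk
        have hdk' : (d : ℝ) ≤ k := by exact_mod_cast h
        rw [Nat.cast_sub h, Nat.cast_sub (h.trans hk)]
        rw [Nat.cast_sub (h.trans hk)] at hnd
        have e : ((k : ℝ) - d) / (n - d) - k / n = -(d * (n - k) / (n - d)) / n := by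
          field_simp; ring
        have e2 : d * ((n : ℝ) - k) / (n - d) ≤ D := by
          rw [div_le_iff₀ hnd]
          have : (0 : ℝ) ≤ d := by positivity
          nlinarith
        rw [e, ← neg_div]
        have e3 : 0 ≤ d * ((n : ℝ) - k) / (n - d) :=
          div_nonneg (mul_nonneg (by positivity) (by linarith)) hnd.le
        have hD0 : (0 : ℝ) ≤ D := by positivity
        exact ⟨by gcongr, by gcongr; linarith⟩
      · rw [Nat.sub_eq_zero_of_le h]
        have : (k : ℝ) / n ≤ D / n := by
          gcongr; exact_mod_cast (by omega)
        simp only [Nat.cast_zero, zero_div, zero_sub]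
        exact ⟨by linarith, by linarith [show (0 : ℝ) ≤ D / n by positivity]⟩
    have e1 : ((k.descFactorial (d + 1) : ℕ) : ℝ) / (n.descFactorial (d + 1) : ℕ) = z * x := by
      rw [Nat.descFactorial_succ, Nat.descFactorial_succ, Nat.cast_mul, Nat.cast_mul,
        mul_div_mul_comm]
    rw [e1, show z * x - y ^ (d + 1) = z * (x - y ^ d) + (z - y) * y ^ d by ring]
    have hyd : |y ^ d| ≤ 1 := by
      rw [abs_of_nonneg (by positivity)]; exact pow_le_one₀ hkn0 hkn
    calc |z * (x - y ^ d) + (z - y) * y ^ d| ≤ |z| * |x - y ^ d| + |z - y| * |y ^ d| := by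
          rw [← abs_mul, ← abs_mul]; exact abs_add_le _ _
      _ ≤ 1 * (d * (D / n)) + D / n * 1 := by
          rw [abs_of_nonneg hz0]
          gcongr
      _ = _ := by push_cast; ring

/-- **Hausdorff moment problem** on `[0, 1]`: a completely monotone sequence with `a 0 = 1` is the
moment sequence of a probability measure, a limit point of the discrete measures with the
Bernstein weights. -/
theorem exists_probabilityMeasure_moments (a : ℕ → ℝ) (ha0 : a 0 = 1)
    (ha : ∀ k l, 0 ≤ riesz a (X ^ k * (1 - X) ^ l)) :
    ∃ μ : ProbabilityMeasure I, ∀ n, ∫ t : I, (t : ℝ) ^ n ∂(μ : Measure I) = a n := by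
  have hw : ∀ n k, 0 ≤ bernWeight a n k := fun n k => by
    rw [bernWeight, map_nsmul]
    exact nsmul_nonneg (ha _ _) _
  have hsum : ∀ n d, d ≤ n → ∑ k : Fin (n + 1), ((k : ℕ).descFactorial d : ℝ) * bernWeight a n k =
      n.descFactorial d * a d := by
    intro n d hd
    rw [Fin.sum_univ_eq_sum_range (fun k => (k.descFactorial d : ℝ) * bernWeight a n k)]
    have := congrArg (riesz a) (sum_descFactorial_smul_bernstein hd)
    simpa only [map_sum, map_smul, riesz_X_pow, smul_eq_mul, bernWeight] using this
  have hsum1 : ∀ n, ∑ k : Fin (n + 1), bernWeight a n k = 1 := fun n => by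
    simpa [ha0] using hsum n 0 (Nat.zero_le _)
  let ν : ℕ → Measure I := fun n =>
    ∑ k : Fin (n + 1), ENNReal.ofReal (bernWeight a n k) • Measure.dirac (bernstein.z k)
  have hν : ∀ n, IsProbabilityMeasure (ν n) := fun n => by
    constructor
    simp only [ν, Measure.coe_finsetSum, Finset.sum_apply, Measure.smul_apply, measure_univ,
      smul_eq_mul, mul_one]
    rw [← ENNReal.ofReal_sum_of_nonneg (f := fun k : Fin (n + 1) => bernWeight a n k)
      fun k _ => hw n k, hsum1, ENNReal.ofReal_one]
  have hint : ∀ n d, ∫ t : I, (t : ℝ) ^ d ∂(ν n) =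
      ∑ k : Fin (n + 1), bernWeight a n k * (((k : ℕ) : ℝ) / n) ^ d := by
    intro n d
    have hc : Continuous fun t : I => (t : ℝ) ^ d := by fun_prop
    simp only [ν]
    rw [integral_finsetSum_measure fun k _ =>
      (Integrable.smul_measure (integrable_dirac (by finiteness)) ENNReal.ofReal_ne_top)]
    refine Finset.sum_congr rfl fun k _ => ?_
    rw [integral_smul_measure, integral_dirac, ENNReal.toReal_ofReal (hw n k), smul_eq_mul]
    rfl
  have hlim : ∀ d, Tendsto (fun n => ∫ t : I, (t : ℝ) ^ d ∂(ν n)) atTop (𝓝 (a d)) := by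
    intro d
    rw [tendsto_iff_norm_sub_tendsto_zero]
    have h0 : Tendsto (fun n : ℕ => (d : ℝ) * (d / n)) atTop (𝓝 0) := by
      simpa using (tendsto_const_div_atTop_nhds_zero_nat (d : ℝ)).const_mul (d : ℝ)
    refine squeeze_zero' (.of_forall fun n => norm_nonneg _) ?_ h0
    filter_upwards [eventually_ge_atTop d] with n hn
    have hnd : (n.descFactorial d : ℝ) ≠ 0 := by
      exact_mod_cast (Nat.descFactorial_pos.2 hn).ne'
    have hd : a d = ∑ k : Fin (n + 1),
        bernWeight a n k * (((k : ℕ).descFactorial d : ℝ) / n.descFactorial d) := by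
      rw [eq_comm, ← mul_right_inj' hnd, ← hsum n d hn, Finset.mul_sum]
      refine Finset.sum_congr rfl fun k _ => ?_
      field_simp
    rw [hint, hd, ← Finset.sum_sub_distrib, Real.norm_eq_abs]
    calc _ ≤ ∑ k : Fin (n + 1), bernWeight a n k * ((d : ℝ) * (d / n)) := by
          refine (Finset.abs_sum_le_sum_abs _ _).trans (Finset.sum_le_sum fun k _ => ?_)
          rw [← mul_sub, abs_mul, abs_of_nonneg (hw n k), abs_sub_comm]
          exact mul_le_mul_of_nonneg_left (abs_descFactorial_div_sub_le (Nat.lt_succ_iff.1 k.2) d d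
            le_rfl hn) (hw n k)
      _ = _ := by rw [← Finset.sum_mul, hsum1, one_mul]
  -- the probability measures on `I` form a compact space
  let P : ℕ → ProbabilityMeasure I := fun n => ⟨ν n, hν n⟩
  let U : Ultrafilter ℕ := Ultrafilter.of atTop
  obtain ⟨μ, -, hμ⟩ := isCompact_univ.ultrafilter_le_nhds (U.map P) (by simp)
  have hT : Tendsto P U (𝓝 μ) := hμ
  refine ⟨μ, fun d => ?_⟩
  rw [ProbabilityMeasure.tendsto_iff_forall_integral_tendsto] at hT
  have h1 := hT (BoundedContinuousFunction.mkOfCompact ⟨fun t : I => (t : ℝ) ^ d, by fun_prop⟩)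
  exact tendsto_nhds_unique h1 ((hlim d).mono_left (Ultrafilter.of_le _))

/-- Weierstrass: on `[0, 1]` the integral of a continuous function is a limit of linear combinations
of moments, with coefficients which do not depend on the measure. -/
lemma exists_tendsto_integral_polynomial (f : C(I, ℝ)) : ∃ p : ℕ → ℝ[X],
    ∀ μ : Measure I, IsFiniteMeasure μ → Tendsto
      (fun k => riesz (fun n => ∫ t : I, (t : ℝ) ^ n ∂μ) (p k)) atTop (𝓝 (∫ t, f t ∂μ)) := by
  have h : ∀ k : ℕ, ∃ p : ℝ[X], ‖p.toContinuousMapOn I - f‖ < 1 / ((k : ℝ) + 1) := fun k =>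
    exists_polynomial_near_continuousMap 0 1 f _ (by positivity)
  choose p hp using h
  refine ⟨p, fun μ hμ => ?_⟩
  have hint : ∀ q : ℝ[X], riesz (fun n => ∫ t : I, (t : ℝ) ^ n ∂μ) q =
      ∫ t : I, q.toContinuousMapOn I t ∂μ := by
    intro q
    simp only [Polynomial.toContinuousMapOn_apply, Polynomial.toContinuousMap_apply,
      eval_eq_sum, Polynomial.sum_def]
    rw [riesz_eq_sum, integral_finsetSum]
    · exact Finset.sum_congr rfl fun i _ => (integral_const_mul _ _).symm
    · intro i _
      exact Continuous.integrable_of_hasCompactSupport (by fun_prop)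
        (HasCompactSupport.of_compactSpace _)
  simp only [hint]
  rw [tendsto_iff_norm_sub_tendsto_zero]
  have h0 : Tendsto (fun k : ℕ => 1 / ((k : ℝ) + 1) * μ.real Set.univ) atTop (𝓝 0) := by
    simpa using tendsto_one_div_add_atTop_nhds_zero_nat.mul_const (μ.real Set.univ)
  refine squeeze_zero (fun _ => norm_nonneg _) (fun k => ?_) h0
  have hi : ∀ g : C(I, ℝ), Integrable g μ := fun g =>
    g.continuous.integrable_of_hasCompactSupport (HasCompactSupport.of_compactSpace _)
  rw [← integral_sub (hi _) (hi _)]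
  refine norm_integral_le_of_norm_le_const (.of_forall fun t => ?_)
  exact (ContinuousMap.norm_coe_le_norm ((p k).toContinuousMapOn I - f) t).trans (hp k).le

/-- A finite measure on `[0, 1]` is determined by its moments. -/
lemma ext_of_moments {μ ν : Measure I} [IsFiniteMeasure μ] [IsFiniteMeasure ν]
    (h : ∀ n, ∫ t : I, (t : ℝ) ^ n ∂μ = ∫ t : I, (t : ℝ) ^ n ∂ν) : μ = ν := by
  refine ext_of_forall_integral_eq_of_IsFiniteMeasure fun f => ?_
  obtain ⟨p, hp⟩ := exists_tendsto_integral_polynomial f.toContinuousMap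
  have h1 := hp μ inferInstance
  rw [funext h] at h1
  exact tendsto_nhds_unique h1 (hp ν inferInstance)

/-- A family of probability measures on `[0, 1]` depends measurably on a parameter as soon as the
moments do. -/
lemma measurable_of_moments {W : Type*} [MeasurableSpace W] (κ : W → Measure I)
    [∀ w, IsProbabilityMeasure (κ w)]
    (h : ∀ n, Measurable fun w => ∫ t : I, (t : ℝ) ^ n ∂(κ w)) : Measurable κ := by
  have hc : ∀ f : C(I, ℝ), Measurable fun w => ∫ t, f t ∂(κ w) := by
    intro f
    obtain ⟨p, hp⟩ := exists_tendsto_integral_polynomial f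
    refine measurable_of_tendsto_metrizable (f := fun k w =>
      riesz (fun n => ∫ t : I, (t : ℝ) ^ n ∂(κ w)) (p k)) (fun k => ?_)
      (tendsto_pi_nhds.2 fun w => hp (κ w) inferInstance)
    simp only [riesz_eq_sum]
    exact Finset.measurable_fun_sum _ fun n _ => (h n).const_mul _
  refine Measurable.measure_of_isPiSystem_of_isProbabilityMeasure
    (borel_eq_generateFrom_isClosed (α := I) ▸ BorelSpace.measurable_eq) isPiSystem_isClosed ?_
  intro F hF
  -- the indicator of a closed set is a limit of continuous functions
  have hlim := fun w => tendsto_lintegral_thickenedIndicator_of_isClosed (κ w) hF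
    (δs := fun n : ℕ => 1 / ((n : ℝ) + 1)) (fun n => by positivity)
    tendsto_one_div_add_atTop_nhds_zero_nat
  refine measurable_of_tendsto_metrizable (fun n => ?_) (tendsto_pi_nhds.2 hlim)
  set g := thickenedIndicator (δ := 1 / ((n : ℝ) + 1)) (by positivity) F with hg
  have he : ∀ w, ∫⁻ t, (g t : ℝ≥0∞) ∂(κ w) = ENNReal.ofReal (∫ t, (g t : ℝ) ∂(κ w)) := fun w => by
    rw [← BoundedContinuousFunction.toReal_lintegral_coe_eq_integral, ENNReal.ofReal_toReal]
    exact (BoundedContinuousFunction.lintegral_lt_top_of_nnreal (κ w) g).ne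
  simp only [he]
  exact (hc ⟨fun t => (g t : ℝ), by fun_prop⟩).ennreal_ofReal

/-! ### Powers of normal operators -/

section NormalOperators

variable {K : Type*} [NormedAddCommGroup K] [InnerProductSpace ℂ K]

lemma mem_graph_prodOp {A B : K →ₗ.[ℂ] K} {f g : K} :
    (f, g) ∈ (prodOp B A).graph ↔ ∃ m, (f, m) ∈ A.graph ∧ (m, g) ∈ B.graph := by
  constructor
  · intro h
    obtain ⟨⟨y, hy, hy'⟩, rfl, h2⟩ := (LinearPMap.mem_graph_iff _).1 h
    refine ⟨A ⟨y, hy⟩, A.mem_graph ⟨y, hy⟩, ?_⟩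
    have h3 : B ⟨A ⟨y, hy⟩, hy'⟩ = g := h2
    rw [← h3]
    exact B.mem_graph ⟨A ⟨y, hy⟩, hy'⟩
  · rintro ⟨m, h1, h2⟩
    obtain ⟨y, rfl, rfl⟩ := (LinearPMap.mem_graph_iff _).1 h1
    obtain ⟨z, hz, rfl⟩ := (LinearPMap.mem_graph_iff _).1 h2
    have hz' : A y ∈ B.domain := by
      have : (z : K) = A y := hz
      exact this ▸ z.2
    refine (LinearPMap.mem_graph_iff _).2 ⟨⟨y, y.2, hz'⟩, rfl, ?_⟩
    exact congrArg B (Subtype.ext hz.symm)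

variable [CompleteSpace K] {N : K →ₗ.[ℂ] K}

lemma mem_graph_adjoint_iff (hN : Dense (N.domain : Set K)) {f g : K} :
    (f, g) ∈ N.adjoint.graph ↔ ∀ a b, (a, b) ∈ N.graph → inner ℂ g a = inner ℂ f b := by
  rw [LinearPMap.adjoint_graph_eq_graph_adjoint hN, Submodule.mem_adjoint_iff]
  refine forall₂_congr fun a b => imp_congr_right fun _ => ?_
  rw [sub_eq_zero, ← inner_conj_symm, ← inner_conj_symm a]
  exact (RingHom.injective _).eq_iff.trans eq_comm

/-- The graph of the restriction of `N` to the domain of `N* N`, as a subspace of the Hilbert sum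
of two copies of `K`. -/
noncomputable def coreGraph (N : K →ₗ.[ℂ] K) : Submodule ℂ (WithLp 2 (K × K)) :=
  (N.graph ⊓ N.adjoint.domain.comap (LinearMap.snd ℂ K K)).comap
    (WithLp.linearEquiv 2 ℂ (K × K)).toLinearMap

lemma mem_coreGraph {p : WithLp 2 (K × K)} :
    p ∈ coreGraph N ↔ (p.fst, p.snd) ∈ N.graph ∧ p.snd ∈ N.adjoint.domain := Iff.rfl

/-- `1 + N* N` is onto when `N` is closed and densely defined (von Neumann): project `(g, 0)` on
the graph of `N`. -/
lemma exists_add_adjoint_mul_self (hc : N.IsClosed) (hd : Dense (N.domain : Set K)) (g : K) :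
    ∃ u v, (u, v) ∈ N.graph ∧ (v, g - u) ∈ N.adjoint.graph := by
  let Gr : Submodule ℂ (WithLp 2 (K × K)) :=
    N.graph.comap (WithLp.linearEquiv 2 ℂ (K × K)).toLinearMap
  have hGr : IsClosed (Gr : Set (WithLp 2 (K × K))) :=
    IsClosed.preimage (WithLp.prod_continuous_ofLp 2 K K) hc
  have : CompleteSpace Gr := hGr.completeSpace_coe
  obtain ⟨w, hw, hw'⟩ := Submodule.HasOrthogonalProjection.exists_orthogonal (K := Gr)
    (WithLp.toLp 2 (g, (0 : K)))
  refine ⟨w.fst, w.snd, hw, (mem_graph_adjoint_iff hd).2 fun a b hab => ?_⟩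
  have h := (Submodule.mem_orthogonal' _ _).1 hw' (WithLp.toLp 2 (a, b)) hab
  rw [WithLp.prod_inner_apply] at h
  simp only [WithLp.ofLp_sub, Prod.fst_sub, Prod.snd_sub, zero_sub, inner_neg_left] at h
  exact eq_of_sub_eq_zero (by rw [sub_eq_add_neg]; exact h)

/-- The domain of `N* N` is a core of a closed operator `N`. -/
lemma mem_closure_coreGraph (hc : N.IsClosed) (hd : Dense (N.domain : Set K)) {h k : K}
    (hk : (h, k) ∈ N.graph) :
    WithLp.toLp 2 (h, k) ∈ closure (coreGraph N : Set (WithLp 2 (K × K))) := by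
  rw [← Submodule.topologicalClosure_coe]
  set G := (coreGraph N).topologicalClosure with hG
  have hGc : IsClosed (G : Set (WithLp 2 (K × K))) := Submodule.isClosed_topologicalClosure _
  have : CompleteSpace G := hGc.completeSpace_coe
  have hsub : ∀ p ∈ G, (p.fst, p.snd) ∈ N.graph := by
    have hcl : IsClosed {p : WithLp 2 (K × K) | (p.fst, p.snd) ∈ N.graph} :=
      IsClosed.preimage (WithLp.prod_continuous_ofLp 2 K K) hc
    exact fun p hp => closure_minimal (fun q hq => (mem_coreGraph.1 hq).1) hcl hp
  obtain ⟨w, hw, hw'⟩ := Submodule.HasOrthogonalProjection.exists_orthogonal (K := G)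
    (WithLp.toLp 2 (h, k))
  set p := WithLp.toLp 2 (h, k) - w with hp
  -- the component `p` of `(h, k)` orthogonal to the core lies in the graph
  have hpg : (p.fst, p.snd) ∈ N.graph := N.graph.sub_mem hk (hsub w hw)
  obtain ⟨u, v, huv, hv⟩ := exists_add_adjoint_mul_self hc hd p.fst
  have hmem : WithLp.toLp 2 (u, v) ∈ G :=
    Submodule.le_topologicalClosure _ (mem_coreGraph.2 ⟨huv, LinearPMap.mem_domain_of_mem_graph hv⟩)
  have h0 := (Submodule.mem_orthogonal _ _).1 hw' _ hmem
  rw [WithLp.prod_inner_apply] at h0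
  have h1 := (mem_graph_adjoint_iff hd).1 hv _ _ hpg
  simp only at h0
  have hfst : p.fst = 0 := by
    rw [← inner_self_eq_zero (𝕜 := ℂ)]
    rw [inner_sub_left] at h1
    have : inner ℂ p.fst p.fst = inner ℂ u p.fst + inner ℂ v p.snd := by rw [← h1]; ring
    rw [this]; exact h0
  have hsnd : p.snd = 0 := by
    rw [hfst] at hpg
    exact LinearPMap.graph_fst_eq_zero_snd N hpg rfl
  have hp0 : p = 0 := by
    apply (WithLp.ofLp_injective 2)
    exact Prod.ext hfst hsnd
  have : WithLp.toLp 2 (h, k) = w := sub_eq_zero.1 hp0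
  rw [this]
  exact hw

lemma IsNormalOp.exists_mem_graph (hN : IsNormalOp N) {f m g : K} (h1 : (f, m) ∈ N.graph)
    (h2 : (m, g) ∈ N.adjoint.graph) :
    ∃ m', (f, m') ∈ N.adjoint.graph ∧ (m', g) ∈ N.graph := by
  rw [← mem_graph_prodOp, ← hN.2.2]
  exact mem_graph_prodOp.2 ⟨m, h1, h2⟩

/-- `‖N* u‖ = ‖N u‖` on the domain of `N* N = N N*`. -/
lemma IsNormalOp.norm_eq (hN : IsNormalOp N) {u v v' : K} (h : (u, v) ∈ N.graph)
    (hv : v ∈ N.adjoint.domain) (h' : (u, v') ∈ N.adjoint.graph) : ‖v'‖ = ‖v‖ := by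
  have hg := N.adjoint.mem_graph ⟨v, hv⟩
  obtain ⟨m, hm, hm'⟩ := hN.exists_mem_graph h hg
  obtain rfl : m = v' := LinearPMap.mem_graph_snd_inj _ hm h' rfl
  have e1 := (mem_graph_adjoint_iff hN.2.1).1 hm _ _ hm'
  have e2 := (mem_graph_adjoint_iff hN.2.1).1 hg _ _ h
  have e : inner ℂ m m = inner ℂ v v := by
    rw [e1, ← inner_conj_symm, e2, inner_conj_symm]
  rw [inner_self_eq_norm_sq_to_K, inner_self_eq_norm_sq_to_K] at e
  have e' : ‖m‖ ^ 2 = ‖v‖ ^ 2 := by exact_mod_cast e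
  exact (sq_eq_sq₀ (norm_nonneg _) (norm_nonneg _)).1 e'

/-- The domain of a normal operator is contained in the domain of its adjoint: approximate in the
graph norm by elements of the domain of `N* N`, along which the images under `N*` form a Cauchy
sequence by `IsNormalOp.norm_eq`. -/
lemma IsNormalOp.exists_adjoint (hN : IsNormalOp N) {h k : K} (hk : (h, k) ∈ N.graph) :
    ∃ k', (h, k') ∈ N.adjoint.graph := by
  obtain ⟨p, hp, hlim⟩ := mem_closure_iff_seq_limit.1 (mem_closure_coreGraph hN.1 hN.2.1 hk)
  have hex : ∀ n, ∃ v', ((p n).fst, v') ∈ N.adjoint.graph := fun n => by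
    obtain ⟨h1, h2⟩ := mem_coreGraph.1 (hp n)
    obtain ⟨m, hm, -⟩ := hN.exists_mem_graph h1 (N.adjoint.mem_graph ⟨_, h2⟩)
    exact ⟨m, hm⟩
  choose v' hv' using hex
  have hlim' := ((WithLp.prod_continuous_ofLp 2 K K).tendsto _).comp hlim
  have hfst : Tendsto (fun n => (p n).fst) atTop (𝓝 h) := (continuous_fst.tendsto _).comp hlim'
  have hsnd : Tendsto (fun n => (p n).snd) atTop (𝓝 k) := (continuous_snd.tendsto _).comp hlim'
  have hcau : CauchySeq v' := by
    have hs := Metric.cauchySeq_iff.1 hsnd.cauchySeq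
    refine Metric.cauchySeq_iff.2 fun ε hε => ?_
    obtain ⟨n₀, hn₀⟩ := hs ε hε
    refine ⟨n₀, fun m hm n hn => ?_⟩
    have hd := (coreGraph N).sub_mem (hp m) (hp n)
    rw [dist_eq_norm, hN.norm_eq (u := (p m).fst - (p n).fst) (v := (p m).snd - (p n).snd)
      (mem_coreGraph.1 hd).1 (mem_coreGraph.1 hd).2
      (show ((p m).fst - (p n).fst, v' m - v' n) ∈ N.adjoint.graph from
        N.adjoint.graph.sub_mem (hv' m) (hv' n))]
    have := hn₀ m hm n hn
    rwa [dist_eq_norm] at this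
  obtain ⟨k', hk'⟩ := cauchySeq_tendsto_of_complete hcau
  refine ⟨k', ?_⟩
  exact (LinearPMap.adjoint_isClosed hN.2.1).mem_of_tendsto (hfst.prodMk_nhds hk')
    (.of_forall hv')

/-- If all powers of a normal operator `N` are defined at `u 0`, with `u n = N ^ n (u 0)`, then
`w i n = N* ^ i N ^ n (u 0)` is defined for all `i`, `n`. -/
lemma IsNormalOp.exists_array (hN : IsNormalOp N) (u : ℕ → K)
    (hu : ∀ n, (u n, u (n + 1)) ∈ N.graph) :
    ∃ w : ℕ → ℕ → K, w 0 = u ∧ (∀ i n, (w i n, w i (n + 1)) ∈ N.graph) ∧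
      ∀ i n, (w i n, w (i + 1) n) ∈ N.adjoint.graph := by
  have step : ∀ u : {u : ℕ → K // ∀ n, (u n, u (n + 1)) ∈ N.graph},
      ∃ u' : {u : ℕ → K // ∀ n, (u n, u (n + 1)) ∈ N.graph},
        ∀ n, (u.1 n, u'.1 n) ∈ N.adjoint.graph := by
    rintro ⟨u, hu⟩
    choose u' hu' using fun n => hN.exists_adjoint (hu n)
    refine ⟨⟨u', fun n => ?_⟩, hu'⟩
    obtain ⟨m, hm, hm'⟩ := hN.exists_mem_graph (hu n) (hu' (n + 1))
    rwa [LinearPMap.mem_graph_snd_inj _ (hu' n) hm rfl]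
  choose F hF using step
  exact ⟨fun i => (F^[i] ⟨u, hu⟩).1, rfl, fun i n => (F^[i] ⟨u, hu⟩).2 n, fun i n => by
    simp only [Function.iterate_succ_apply']
    exact hF _ n⟩

/-- The squared norms of the powers of a normal operator at a vector form Hankel matrices of Gram
type: both `‖u (i + j)‖²` and `‖u (i + j + 1)‖²`. -/
lemma IsNormalOp.exists_gram (hN : IsNormalOp N) (u : ℕ → K)
    (hu : ∀ n, (u n, u (n + 1)) ∈ N.graph) (d : ℕ) :
    ∃ v : ℕ → K, ∀ i j, (inner ℂ (v i) (v j)).re = ‖u (i + j + d)‖ ^ 2 := by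
  obtain ⟨w, rfl, h1, h2⟩ := hN.exists_array u hu
  have hadj : ∀ i n i' n', inner ℂ (w (i + 1) n) (w i' n') = inner ℂ (w i n) (w i' (n' + 1)) :=
    fun i n i' n' => (mem_graph_adjoint_iff hN.2.1).1 (h2 i n) _ _ (h1 i' n')
  have hadj' : ∀ i n i' n', inner ℂ (w i n) (w i' n') = inner ℂ (w 0 n) (w i' (n' + i)) := by
    intro i
    induction i with
    | zero => simp
    | succ i ih =>
      intro n i' n'
      rw [hadj, ih, show n' + 1 + i = n' + (i + 1) by ring]
  refine ⟨fun i => w i (i + d), fun i j => ?_⟩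
  rw [hadj', ← inner_conj_symm, hadj', ← inner_conj_symm, Complex.conj_conj,
    show i + d + j = i + j + d by ring, show j + d + i = i + j + d by ring]
  exact (norm_sq_eq_re_inner (𝕜 := ℂ) _).symm

end NormalOperators

/-! ### The densities of the powers of the weighted composition operator -/

section Weights

lemma Lp_enorm_sq {W : Type*} [MeasurableSpace W] {ϱ : Measure W} (g : Lp ℂ 2 ϱ) :
    ∫⁻ w, ‖g w‖ₑ ^ 2 ∂ϱ = ‖g‖ₑ ^ 2 := by
  rw [Lp.enorm_def, eLpNorm_eq_lintegral_rpow_enorm_toReal (by simp) (by simp)]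
  rw [← ENNReal.rpow_natCast, ← ENNReal.rpow_mul]
  simp

lemma lp_enorm_sq {X W : Type*} [MeasurableSpace W] {ϱ : Measure W}
    (f : lp (fun _ : X => Lp ℂ 2 ϱ) 2) : ∑' x, ‖f x‖ₑ ^ 2 = ‖f‖ₑ ^ 2 := by
  have h := lp.hasSum_norm (p := 2) (by simp) f
  simp only [ENNReal.toReal_ofNat, Real.rpow_ofNat] at h
  rw [← ofReal_norm f, ← ENNReal.ofReal_pow (norm_nonneg _), ← h.tsum_eq,
    ENNReal.ofReal_tsum_of_nonneg (fun _ => by positivity) h.summable]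
  exact tsum_congr fun x => by rw [ENNReal.ofReal_pow (norm_nonneg _), ofReal_norm]

variable {X W : Type*}

/-- The weights `∑ |λ_y λ_{φ(y)} ⋯ λ_{φ^{n-1}(y)}|²`, summed over `y ∈ φ^{-n}({x})`, defined by
recursion on `n`. They are the densities of `f ↦ ‖C_{φ,Λ}^n f‖²`. -/
noncomputable def orbitWeight (φ : X → X) (lam : X → W → ℂ) : ℕ → X → W → ℝ≥0∞
  | 0, _, _ => 1
  | n + 1, x, w => ∑' y : φ ⁻¹' {x}, ‖lam y w‖ₑ ^ 2 * orbitWeight φ lam n y w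

variable {φ : X → X} {lam : X → W → ℂ}

@[simp] lemma orbitWeight_zero (x : X) (w : W) : orbitWeight φ lam 0 x w = 1 := rfl

lemma orbitWeight_succ (n : ℕ) (x : X) (w : W) : orbitWeight φ lam (n + 1) x w =
    ∑' y : φ ⁻¹' {x}, ‖lam y w‖ₑ ^ 2 * orbitWeight φ lam n y w := rfl

variable [Countable X] [MeasurableSpace W]

lemma measurable_orbitWeight (hlam : ∀ x, Measurable (lam x)) (n : ℕ) (x : X) :
    Measurable (orbitWeight φ lam n x) := by
  induction n generalizing x with
  | zero => exact measurable_const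
  | succ n ih =>
    exact Measurable.tsum fun y => ((hlam y).enorm.pow_const 2).mul (ih y)

variable {ϱ : Measure W}

/-- The recursion for the weights, in integrated form, when `g = C_{φ,Λ} f`. -/
lemma tsum_lintegral_orbitWeight_comp (hlam : ∀ x, Measurable (lam x))
    {f g : lp (fun _ : X => Lp ℂ 2 ϱ) 2}
    (h : ∀ x, (g x : W → ℂ) =ᵐ[ϱ] fun w => lam x w * f (φ x) w) (n : ℕ) :
    ∑' x, ∫⁻ w, orbitWeight φ lam n x w * ‖g x w‖ₑ ^ 2 ∂ϱ =
      ∑' x, ∫⁻ w, orbitWeight φ lam (n + 1) x w * ‖f x w‖ₑ ^ 2 ∂ϱ := by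
  rw [← ENNReal.tsum_fiberwise _ φ]
  refine tsum_congr fun x => ?_
  simp only [orbitWeight_succ, ← ENNReal.tsum_mul_right]
  rw [lintegral_tsum fun y => ?_]
  · refine tsum_congr fun y => lintegral_congr_ae ?_
    obtain ⟨y, rfl⟩ := y
    filter_upwards [h y] with w hw
    rw [hw, enorm_mul]
    ring
  · exact ((((hlam y).enorm.pow_const 2).mul (measurable_orbitWeight hlam n y)).aemeasurable).mul
      ((Lp.aestronglyMeasurable _).enorm.pow_const 2)

lemma enorm_iterate_sq (hlam : ∀ x, Measurable (lam x))
    {T : lp (fun _ : X => Lp ℂ 2 ϱ) 2 → lp (fun _ : X => Lp ℂ 2 ϱ) 2}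
    (hT : ∀ f x, (T f x : W → ℂ) =ᵐ[ϱ] fun w => lam x w * f (φ x) w)
    (n : ℕ) (f : lp (fun _ : X => Lp ℂ 2 ϱ) 2) :
    ‖T^[n] f‖ₑ ^ 2 = ∑' x, ∫⁻ w, orbitWeight φ lam n x w * ‖f x w‖ₑ ^ 2 ∂ϱ := by
  have h : ∀ m k, ∑' x, ∫⁻ w, orbitWeight φ lam k x w * ‖T^[m] f x w‖ₑ ^ 2 ∂ϱ =
      ∑' x, ∫⁻ w, orbitWeight φ lam (k + m) x w * ‖f x w‖ₑ ^ 2 ∂ϱ := by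
    intro m
    induction m with
    | zero => simp
    | succ m ih =>
      intro k
      rw [Function.iterate_succ_apply', tsum_lintegral_orbitWeight_comp hlam (hT _), ih,
        add_right_comm, add_assoc]
  rw [← lp_enorm_sq, ← zero_add n, ← h]
  simp only [zero_add, orbitWeight_zero, one_mul, Lp_enorm_sq]

open Classical in
/-- For `f` concentrated at `x` and equal there to the indicator of `A`, `‖C_{φ,Λ}^n f‖²` is the
integral of the `n`-th weight over `A`. -/
lemma enorm_iterate_single_sq (hlam : ∀ x, Measurable (lam x))
    {T : lp (fun _ : X => Lp ℂ 2 ϱ) 2 → lp (fun _ : X => Lp ℂ 2 ϱ) 2}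
    (hT : ∀ f x, (T f x : W → ℂ) =ᵐ[ϱ] fun w => lam x w * f (φ x) w)
    (n : ℕ) (x : X) {A : Set W} (hA : MeasurableSet A) (hA' : ϱ A ≠ ∞) :
    ‖T^[n] (lp.single 2 x (indicatorConstLp 2 hA hA' (1 : ℂ)))‖ₑ ^ 2 =
      ∫⁻ w in A, orbitWeight φ lam n x w ∂ϱ := by
  rw [enorm_iterate_sq hlam hT, tsum_eq_single x]
  · rw [lp.single_apply_self, ← lintegral_indicator hA]
    refine lintegral_congr_ae ?_
    filter_upwards [indicatorConstLp_coeFn (p := 2) (hs := hA) (hμs := hA') (c := (1 : ℂ))] with w hw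
    rw [hw]
    by_cases hwA : w ∈ A <;> simp [hwA]
  · intro y hy
    rw [lp.single_apply_ne _ _ _ hy, lintegral_eq_zero_iff']
    · filter_upwards [Lp.coeFn_zero ℂ 2 ϱ] with w hw
      change orbitWeight φ lam n y w * ‖((0 : Lp ℂ 2 ϱ) : W → ℂ) w‖ₑ ^ 2 = 0
      rw [hw]
      simp
    · exact (measurable_orbitWeight hlam n y).aemeasurable.mul
        ((Lp.aestronglyMeasurable _).enorm.pow_const 2)

variable [SigmaFinite ϱ]

/-- The growth condition: a bound on the powers of the operator bounds the weights. -/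
lemma ae_orbitWeight_le (hlam : ∀ x, Measurable (lam x))
    {T : lp (fun _ : X => Lp ℂ 2 ϱ) 2 → lp (fun _ : X => Lp ℂ 2 ϱ) 2}
    (hT : ∀ f x, (T f x : W → ℂ) =ᵐ[ϱ] fun w => lam x w * f (φ x) w) {c : ℝ≥0}
    (hc : ∀ n f, ‖T^[n] f‖ₑ ^ 2 ≤ (c : ℝ≥0∞) ^ n * ‖f‖ₑ ^ 2) (n : ℕ) (x : X) :
    ∀ᵐ w ∂ϱ, orbitWeight φ lam n x w ≤ (c : ℝ≥0∞) ^ n := by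
  classical
  refine ae_le_of_forall_setLIntegral_le_of_sigmaFinite (measurable_orbitWeight hlam n x)
    fun A hA hA' => ?_
  rw [← enorm_iterate_single_sq hlam hT n x hA hA'.ne]
  refine (hc n _).trans_eq ?_
  have := enorm_iterate_single_sq hlam hT 0 x hA hA'.ne
  rw [Function.iterate_zero, id] at this
  rw [this]
  simp

/-- Complete monotonicity passes from the sequences `‖C_{φ,Λ}^n f‖²` to their densities. -/
lemma ae_riesz_orbitWeight_nonneg (hlam : ∀ x, Measurable (lam x))
    {T : lp (fun _ : X => Lp ℂ 2 ϱ) 2 → lp (fun _ : X => Lp ℂ 2 ϱ) 2}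
    (hT : ∀ f x, (T f x : W → ℂ) =ᵐ[ϱ] fun w => lam x w * f (φ x) w) {c : ℝ≥0}
    (hc : ∀ n f, ‖T^[n] f‖ₑ ^ 2 ≤ (c : ℝ≥0∞) ^ n * ‖f‖ₑ ^ 2) (p : ℝ[X])
    (hp : ∀ f, 0 ≤ riesz (fun n => ‖T^[n] f‖ ^ 2 / c ^ n) p) (x : X) :
    ∀ᵐ w ∂ϱ, 0 ≤ riesz (fun n => (orbitWeight φ lam n x w).toReal / c ^ n) p := by
  classical
  have hint : ∀ A, ϱ A < ∞ → ∀ n, IntegrableOn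
      (fun w => (orbitWeight φ lam n x w).toReal / c ^ n) A ϱ := by
    intro A hA n
    refine Integrable.div_const (Measure.integrableOn_of_bounded (M := (c : ℝ) ^ n) hA.ne
      (measurable_orbitWeight hlam n x).ennreal_toReal.aestronglyMeasurable ?_) _
    filter_upwards [ae_restrict_of_ae (ae_orbitWeight_le hlam hT hc n x)] with w hw
    rw [Real.norm_of_nonneg ENNReal.toReal_nonneg]
    simpa using ENNReal.toReal_mono (by finiteness) hw
  refine ae_nonneg_of_forall_setIntegral_nonneg_of_sigmaFinite (fun A hA hA' => ?_)
    fun A hA hA' => ?_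
  · simp only [riesz_eq_sum]
    exact integrable_finsetSum _ fun n _ => (hint A hA' n).const_mul _
  · have key : ∀ n, ∫ w in A, (orbitWeight φ lam n x w).toReal / c ^ n ∂ϱ =
        ‖T^[n] (lp.single 2 x (indicatorConstLp 2 hA hA'.ne (1 : ℂ)))‖ ^ 2 / c ^ n := by
      intro n
      rw [integral_div, integral_toReal (measurable_orbitWeight hlam n x).aemeasurable,
        ← enorm_iterate_single_sq hlam hT n x hA hA'.ne, ENNReal.toReal_pow, toReal_enorm]
      filter_upwards [ae_restrict_of_ae (ae_orbitWeight_le hlam hT hc n x)] with w hw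
      exact hw.trans_lt (by finiteness)
    have h := hp (lp.single 2 x (indicatorConstLp 2 hA hA'.ne (1 : ℂ)))
    simp only [← key, riesz_eq_sum] at h
    simp only [riesz_eq_sum]
    rw [integral_finsetSum _ fun n _ => (hint A hA' n).const_mul _]
    simpa only [integral_const_mul] using h

end Weights

/-! ### Complete monotonicity for bounded subnormal operators -/

section Subnormal

/-- For a bounded everywhere defined subnormal operator `T`, the sequence `‖T ^ n f‖²`, scaled by
the powers of a bound `c` of `‖T‖²`, is completely monotone. -/
lemma IsSubnormalOp.riesz_nonneg {E : Type*} [NormedAddCommGroup E] [InnerProductSpace ℂ E]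
    {S : E →ₗ.[ℂ] E} (hS : IsSubnormalOp S) {T : E → E} (hT : ∀ f, (f, T f) ∈ S.graph) {c : ℝ≥0}
    (hc0 : c ≠ 0) (hc : ∀ n f, ‖T^[n] f‖ₑ ^ 2 ≤ (c : ℝ≥0∞) ^ n * ‖f‖ₑ ^ 2) (f : E) (k l : ℕ) :
    0 ≤ riesz (fun n => ‖T^[n] f‖ ^ 2 / c ^ n) (X ^ k * (1 - X) ^ l) := by
  obtain ⟨-, K, _, _, _, J, N, hN, hJ⟩ := hS
  have hu : ∀ n, (J (T^[n] f), J (T^[n + 1] f)) ∈ N.graph := by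
    intro n
    obtain ⟨⟨y, hy⟩, h1, h2⟩ := (LinearPMap.mem_graph_iff _).1 (hT (T^[n] f))
    obtain rfl : y = T^[n] f := h1
    obtain ⟨hy', hy2⟩ := hJ ⟨T^[n] f, hy⟩
    rw [Function.iterate_succ_apply', ← show S ⟨T^[n] f, hy⟩ = T (T^[n] f) from h2, ← hy2]
    exact N.mem_graph ⟨_, hy'⟩
  have hpos : ∀ (d : ℕ) (p : ℝ[X]),
      0 ≤ riesz (fun n => ‖T^[n] f‖ ^ 2 / c ^ n) (X ^ d * p ^ 2) := by
    intro d p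
    obtain ⟨v, hv⟩ := hN.exists_gram (fun n => J (T^[n] f)) hu d
    have hcr : (0 : ℝ) < c := by positivity
    -- the scaling by powers of `c` is absorbed into the Gram vectors
    have h := riesz_sq_nonneg (fun n => ‖T^[n] f‖ ^ 2 / c ^ n * c ^ d) d
      (fun i => (((c : ℝ) ^ i)⁻¹ : ℂ) • v i) (fun i j => ?_) p
    · have e : riesz (fun n => ‖T^[n] f‖ ^ 2 / c ^ n * c ^ d) (X ^ d * p ^ 2) =
          riesz (fun n => ‖T^[n] f‖ ^ 2 / c ^ n) (X ^ d * p ^ 2) * c ^ d := by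
        rw [riesz_eq_sum, riesz_eq_sum, Finset.sum_mul]
        exact Finset.sum_congr rfl fun _ _ => by ring
      rw [e] at h
      exact nonneg_of_mul_nonneg_left h (by positivity)
    · have := hv i j
      rw [LinearIsometry.norm_map] at this
      have e : ∀ i : ℕ, (((c : ℝ) ^ i)⁻¹ : ℂ) = (((c : ℝ) ^ i)⁻¹ : ℝ) := fun i => by push_cast; rfl
      rw [e, e, inner_smul_left, inner_smul_right, Complex.conj_ofReal, Complex.re_ofReal_mul,
        Complex.re_ofReal_mul, this]
      field_simp
      ring
  refine riesz_hausdorff_nonneg _ (fun p => by simpa using hpos 0 p)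
    (fun p => by simpa using hpos 1 p) (‖f‖ ^ 2) (fun n => ?_) k l
  have hcr : (0 : ℝ) < c := by positivity
  rw [abs_of_nonneg (by positivity), div_le_iff₀ (by positivity)]
  have := ENNReal.toReal_mono (by finiteness) (hc n f)
  simpa [mul_comm] using this

lemma IsBoundedOp.exists_iterate {E : Type*} [NormedAddCommGroup E] [InnerProductSpace ℂ E]
    {S : E →ₗ.[ℂ] E} (hS : IsBoundedOp S) : ∃ (T : E → E) (c : ℝ≥0), c ≠ 0 ∧
      (∀ f, (f, T f) ∈ S.graph) ∧ ∀ n f, ‖T^[n] f‖ₑ ^ 2 ≤ (c : ℝ≥0∞) ^ n * ‖f‖ₑ ^ 2 := by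
  obtain ⟨hdom, c, hc⟩ := hS
  have hd : ∀ f, f ∈ S.domain := fun f => hdom ▸ Submodule.mem_top
  set C : ℝ≥0 := max c.toNNReal 1
  refine ⟨fun f => S ⟨f, hd f⟩, C ^ 2, by positivity, fun f => S.mem_graph ⟨f, hd f⟩, ?_⟩
  have h1 : ∀ f, ‖S ⟨f, hd f⟩‖ₑ ≤ C * ‖f‖ₑ := by
    intro f
    have : ‖S ⟨f, hd f⟩‖ ≤ C * ‖f‖ := (hc ⟨f, hd f⟩).trans <| by
      gcongr
      exact (Real.le_coe_toNNReal c).trans (by exact_mod_cast le_max_left _ _)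
    rw [← ofReal_norm, ← ofReal_norm, ← ENNReal.ofReal_coe_nnreal, ← ENNReal.ofReal_mul C.coe_nonneg]
    exact ENNReal.ofReal_le_ofReal this
  intro n
  induction n with
  | zero => simp
  | succ n ih =>
    intro f
    rw [Function.iterate_succ_apply']
    refine (pow_le_pow_left₀ zero_le (h1 _) 2).trans ?_
    rw [mul_pow, pow_succ' _ n, mul_assoc, ENNReal.coe_pow]
    exact mul_le_mul_right (by simpa using ih f) _

lemma mulWeightedComp_coeFn {X W : Type*} [MeasurableSpace W] {ϱ : Measure W} {φ : X → X}
    {lam : X → W → ℂ} (f : (mulWeightedComp ϱ φ lam).domain) (x : X) :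
    (mulWeightedComp ϱ φ lam f x : W → ℂ) =ᵐ[ϱ] fun w => lam x w * f.1 (φ x) w :=
  MemLp.coeFn_toLp (f := fun w => lam x w * f.1 (φ x) w) (f.2.choose x)

/-- For a bounded subnormal operator, almost every fibre carries completely monotone weights. -/
lemma exists_ae_riesz_orbitWeight {X W : Type*} [Countable X] [MeasurableSpace W]
    (ϱ : Measure W) [SigmaFinite ϱ]
    (φ : X → X) (lam : X → W → ℂ) (hlam : ∀ x, Measurable (lam x))
    (hbdd : IsBoundedOp (mulWeightedComp ϱ φ lam))
    (hsub : IsSubnormalOp (mulWeightedComp ϱ φ lam)) :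
    ∃ c : ℝ≥0, c ≠ 0 ∧ ∀ᵐ w ∂ϱ, ∀ x,
      (∀ n, orbitWeight φ lam n x w ≤ (c : ℝ≥0∞) ^ n) ∧
      ∀ k l, 0 ≤ riesz (fun n => (orbitWeight φ lam n x w).toReal / c ^ n)
        (Polynomial.X ^ k * (1 - Polynomial.X) ^ l) := by
  obtain ⟨T, c, hc0, hT, hc⟩ := hbdd.exists_iterate
  have hT' : ∀ f x, (T f x : W → ℂ) =ᵐ[ϱ] fun w => lam x w * f (φ x) w := by
    intro f x
    obtain ⟨⟨y, hy⟩, h1, h2⟩ := (LinearPMap.mem_graph_iff _).1 (hT f)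
    obtain rfl : y = f := h1
    have h3 : mulWeightedComp ϱ φ lam ⟨y, hy⟩ = T y := h2
    rw [← h3]
    exact mulWeightedComp_coeFn ⟨y, hy⟩ x
  refine ⟨c, hc0, ae_all_iff.2 fun x => ?_⟩
  have h1 := ae_all_iff.2 fun n => ae_orbitWeight_le hlam hT' hc n x
  have h2 := ae_all_iff.2 fun k : ℕ => ae_all_iff.2 fun l : ℕ =>
    ae_riesz_orbitWeight_nonneg hlam hT' hc (Polynomial.X ^ k * (1 - Polynomial.X) ^ l)
      (fun f => hsub.riesz_nonneg hT hc0 hc f k l) x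
  filter_upwards [h1, h2] with w h1 h2
  exact ⟨h1, h2⟩

end Subnormal

/-! ### The kernels of representing measures -/

section Fibres

lemma ext_of_lintegral_moments {μ ν : Measure I} [IsFiniteMeasure μ] [IsFiniteMeasure ν]
    (h : ∀ n, ∫⁻ t : I, ENNReal.ofReal t ^ n ∂μ = ∫⁻ t : I, ENNReal.ofReal t ^ n ∂ν) : μ = ν := by
  refine ext_of_moments fun n => ?_
  have e : ∀ ξ : Measure I, ∫ t : I, (t : ℝ) ^ n ∂ξ =
      (∫⁻ t : I, ENNReal.ofReal t ^ n ∂ξ).toReal := fun ξ => by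
    rw [integral_eq_lintegral_of_nonneg_ae (.of_forall fun t => pow_nonneg t.2.1 n) (by fun_prop)]
    exact congrArg _ (lintegral_congr fun t => ENNReal.ofReal_pow t.2.1 n)
  rw [e, e, h]

variable {X W : Type*} [MeasurableSpace W]

/-- The identity `t ϑ_x^w (dt) = ∑_{y ∈ φ⁻¹({x})} |λ_y(w)|² ϑ_y^w (dt)` in the fibre over `w`,
tested on nonnegative functions. -/
def FibreIdentity (φ : X → X) (lam : X → W → ℂ) (ϑ : X → Kernel W ℝ≥0) (w : W) : Prop :=
  ∀ (x : X) (f : ℝ≥0 → ℝ≥0∞), Measurable f →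
    ∫⁻ t, (t : ℝ≥0∞) * f t ∂(ϑ x w) = ∑' y : φ ⁻¹' {x}, ‖lam y w‖ₑ ^ 2 * ∫⁻ t, f t ∂(ϑ y w)

/-- Measures on `[0, 1]` whose moments are the scaled weights satisfy the scaled form of the
identity `t ϑ_x = ∑ |λ_y|² ϑ_y`, because the moments of both sides agree. -/
lemma withDensity_eq_sum_of_moments {X W : Type*} {φ : X → X} {lam : X → W → ℂ} {w : W}
    {c : ℝ≥0} (hc : c ≠ 0)
    (hM : ∀ x n, orbitWeight φ lam n x w ≤ (c : ℝ≥0∞) ^ n) (κ : X → Measure I)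
    [∀ x, IsProbabilityMeasure (κ x)]
    (hκ : ∀ x n, ∫ t : I, (t : ℝ) ^ n ∂(κ x) = (orbitWeight φ lam n x w).toReal / c ^ n) (x : X) :
    (κ x).withDensity (fun t => c * ENNReal.ofReal t) =
      Measure.sum fun y : φ ⁻¹' {x} => ‖lam y w‖ₑ ^ 2 • κ y := by
  have hc' : (c : ℝ≥0∞) ≠ 0 := by exact_mod_cast hc
  have hm : ∀ x n, ∫⁻ t : I, ENNReal.ofReal t ^ n ∂(κ x) = orbitWeight φ lam n x w / c ^ n := by
    intro x n
    have h := hκ x n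
    have e : ∫⁻ t : I, ENNReal.ofReal t ^ n ∂(κ x) =
        ENNReal.ofReal (∫ t : I, (t : ℝ) ^ n ∂(κ x)) := by
      rw [ofReal_integral_eq_lintegral_ofReal]
      · exact lintegral_congr fun t => (ENNReal.ofReal_pow t.2.1 n).symm
      · exact Continuous.integrable_of_hasCompactSupport (by fun_prop)
          (HasCompactSupport.of_compactSpace _)
      · exact .of_forall fun t => pow_nonneg t.2.1 n
    have hfin : orbitWeight φ lam n x w ≠ ∞ := ((hM x n).trans_lt (by finiteness)).ne
    rw [e, h, ENNReal.ofReal_div_of_pos (by positivity), ENNReal.ofReal_toReal hfin,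
      ENNReal.ofReal_pow c.coe_nonneg, ENNReal.ofReal_coe_nnreal]
  have hmeas : Measurable fun t : I => (c : ℝ≥0∞) * ENNReal.ofReal t := by fun_prop
  have : IsFiniteMeasure ((κ x).withDensity fun t => c * ENNReal.ofReal t) := by
    refine isFiniteMeasure_withDensity (ne_of_lt ?_)
    calc ∫⁻ t : I, (c : ℝ≥0∞) * ENNReal.ofReal t ∂(κ x) ≤ ∫⁻ _ : I, (c : ℝ≥0∞) ∂(κ x) := by
          refine lintegral_mono fun t => ?_
          refine mul_le_of_le_one_right' ?_
          exact ENNReal.ofReal_le_one.2 t.2.2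
      _ < ∞ := by simp
  have : IsFiniteMeasure (Measure.sum fun y : φ ⁻¹' {x} => ‖lam y w‖ₑ ^ 2 • κ y) := by
    constructor
    rw [Measure.sum_apply _ MeasurableSet.univ]
    have := (hM x 1).trans_lt (by finiteness : (c : ℝ≥0∞) ^ 1 < ∞)
    simpa [orbitWeight_succ] using this
  refine ext_of_lintegral_moments fun n => ?_
  rw [lintegral_withDensity_eq_lintegral_mul _ hmeas (by fun_prop), lintegral_sum_measure]
  simp only [Pi.mul_apply, lintegral_smul_measure, hm, smul_eq_mul]
  simp only [mul_assoc, ← pow_succ']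
  rw [lintegral_const_mul _ (by fun_prop), hm, orbitWeight_succ]
  simp only [div_eq_mul_inv, ← mul_assoc]
  rw [ENNReal.tsum_mul_right, mul_comm (c : ℝ≥0∞), mul_assoc]
  congr 1
  rw [pow_succ, ENNReal.mul_inv (by simp) (by simp), mul_comm, mul_assoc,
    ENNReal.inv_mul_cancel hc' (by simp), mul_one]

/-- The kernels: `ϑ x w` is the representing measure of the weights at `(x, w)` for `w` in a
conull measurable set, and the point mass at `0` elsewhere. -/
lemma exists_kernel_fibreIdentity [Countable X] (ϱ : Measure W) (φ : X → X) (lam : X → W → ℂ)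
    (hlam : ∀ x, Measurable (lam x)) {c : ℝ≥0} (hc : c ≠ 0)
    (h : ∀ᵐ w ∂ϱ, ∀ x, (∀ n, orbitWeight φ lam n x w ≤ (c : ℝ≥0∞) ^ n) ∧
      ∀ k l, 0 ≤ riesz (fun n => (orbitWeight φ lam n x w).toReal / c ^ n)
        (Polynomial.X ^ k * (1 - Polynomial.X) ^ l)) :
    ∃ ϑ : X → Kernel W ℝ≥0, (∀ x, IsMarkovKernel (ϑ x)) ∧
      (∀ w, (∀ x, ϑ x w = Measure.dirac 0) ∨ FibreIdentity φ lam ϑ w) ∧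
      ∀ᵐ w ∂ϱ, FibreIdentity φ lam ϑ w := by
  classical
  obtain ⟨s, hs, hsm, hgood⟩ := h.exists_measurable_mem
  have hex : ∀ x w, ∃ μ : ProbabilityMeasure I,
      (w ∈ s → ∀ n, ∫ t : I, (t : ℝ) ^ n ∂(μ : Measure I) =
        (orbitWeight φ lam n x w).toReal / c ^ n) ∧
      (w ∉ s → (μ : Measure I) = Measure.dirac 0) := by
    intro x w
    by_cases hw : w ∈ s
    · obtain ⟨μ, hμ⟩ := exists_probabilityMeasure_moments
        (fun n => (orbitWeight φ lam n x w).toReal / c ^ n) (by simp) ((hgood w hw x).2)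
      exact ⟨μ, fun _ => hμ, fun h => absurd hw h⟩
    · exact ⟨⟨Measure.dirac 0, inferInstance⟩, fun h => absurd h hw, fun _ => rfl⟩
  choose κ hκ hκ' using hex
  have hmeas : ∀ x, Measurable fun w => (κ x w : Measure I) := by
    intro x
    refine measurable_of_moments _ fun n => ?_
    have e : (fun w => ∫ t : I, (t : ℝ) ^ n ∂(κ x w : Measure I)) =
        s.piecewise (fun w => (orbitWeight φ lam n x w).toReal / c ^ n) fun _ => (0 : ℝ) ^ n := by
      funext w
      by_cases hw : w ∈ s
      · simp [hw, hκ x w hw n]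
      · simp [hw, hκ' x w hw]
    rw [e]
    exact ((measurable_orbitWeight hlam n x).ennreal_toReal.div_const _).piecewise hsm
      measurable_const
  let e : I → ℝ≥0 := fun t => c * unitInterval.toNNReal t
  have he : Measurable e := by
    have : Continuous e := by fun_prop
    exact this.measurable
  let ϑ : X → Kernel W ℝ≥0 := fun x =>
    { toFun := fun w => (κ x w : Measure I).map e
      measurable' := (Measure.measurable_map e he).comp (hmeas x) }
  have hϑ : ∀ x w, ϑ x w = (κ x w : Measure I).map e := fun _ _ => rfl
  have hid : ∀ w ∈ s, FibreIdentity φ lam ϑ w := by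
    intro w hw x f hf
    have key := withDensity_eq_sum_of_moments hc (fun x => (hgood w hw x).1)
      (fun x => (κ x w : Measure I)) (fun x => hκ x w hw) x
    simp only [hϑ]
    rw [lintegral_map (by fun_prop) he]
    simp only [lintegral_map hf he]
    have h1 := congrArg (fun μ => ∫⁻ t, f (e t) ∂μ) key
    simp only [lintegral_sum_measure] at h1
    rw [lintegral_withDensity_eq_lintegral_mul (g := fun t => f (e t)) _ (by fun_prop)
      (hf.comp he)] at h1
    simp only [lintegral_smul_measure, smul_eq_mul] at h1
    rw [← h1]
    refine lintegral_congr fun t => ?_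
    simp only [Pi.mul_apply, e, ENNReal.coe_mul]
    congr 2
    rw [ENNReal.ofReal, Real.toNNReal_of_nonneg t.2.1]
    rfl
  refine ⟨ϑ, fun x => ⟨fun w => ?_⟩, fun w => ?_, ?_⟩
  · rw [hϑ]
    exact Measure.isProbabilityMeasure_map he.aemeasurable
  · by_cases hw : w ∈ s
    · exact Or.inr (hid w hw)
    · refine Or.inl fun x => ?_
      rw [hϑ, hκ' x w hw, Measure.map_dirac' he]
      congr 1
      simp [e]
  · exact mem_of_superset hs hid

lemma FibreIdentity.absolutelyContinuous {φ : X → X} {lam : X → W → ℂ} {ϑ : X → Kernel W ℝ≥0}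
    {w : W} (h : FibreIdentity φ lam ϑ w) (x : X) : ‖lam x w‖ₑ ^ 2 • ϑ x w ≪ ϑ (φ x) w := by
  refine Measure.AbsolutelyContinuous.mk fun A hA h0 => ?_
  have h1 := h (φ x) (A.indicator 1) (measurable_one.indicator hA)
  have h2 : ∫⁻ t, (t : ℝ≥0∞) * A.indicator 1 t ∂(ϑ (φ x) w) = 0 := by
    rw [lintegral_eq_zero_iff (by fun_prop (disch := exact hA))]
    filter_upwards [measure_eq_zero_iff_ae_notMem.1 h0] with t ht
    simp [ht]
  rw [h2, eq_comm, ENNReal.tsum_eq_zero] at h1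
  have h3 := h1 ⟨x, rfl⟩
  rwa [lintegral_indicator_one hA] at h3

end Fibres

/-! ### The measures on the product space and their derivatives -/

section Derivatives

variable {X W : Type*} [MeasurableSpace W] {ϱ : Measure W} [SigmaFinite ϱ] {φ : X → X}
  {lam : X → W → ℂ} {ϑ : X → Kernel W ℝ≥0}

lemma sigmaFinite_hatMeasure (x : X) [IsMarkovKernel (ϑ x)] : SigmaFinite (hatMeasure ϱ ϑ x) := by
  refine ⟨⟨⟨fun n => spanningSets ϱ n ×ˢ Set.univ, fun _ => trivial, fun n => ?_, ?_⟩⟩⟩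
  · rw [hatMeasure, Measure.compProd_apply_prod (measurableSet_spanningSets ϱ n) MeasurableSet.univ]
    simp only [measure_univ, lintegral_const, Measure.restrict_apply_univ, one_mul]
    exact measure_spanningSets_lt_top ϱ n
  · rw [← Set.iUnion_prod_const, iUnion_spanningSets, Set.univ_prod_univ]

/-- Integrating the fibre identities: `t ϱ̂_x = ∑_{y ∈ φ⁻¹({x})} |λ̂_y|² ϱ̂_y`. -/
lemma withDensity_hatMeasure_eq_sum [Countable X] (hlam : ∀ x, Measurable (lam x))
    [∀ x, IsMarkovKernel (ϑ x)] (h : ∀ᵐ w ∂ϱ, FibreIdentity φ lam ϑ w) (x : X) :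
    (hatMeasure ϱ ϑ x).withDensity (fun p => (p.2 : ℝ≥0∞)) =
      Measure.sum fun y : φ ⁻¹' {x} => hatWeightedMeasure ϱ lam ϑ y := by
  refine Measure.ext fun A hA => ?_
  rw [Measure.sum_apply _ hA, withDensity_apply _ hA, ← lintegral_indicator hA, hatMeasure,
    Measure.lintegral_compProd (Measurable.indicator (by fun_prop) hA)]
  have hm : ∀ y : X, Measurable fun p : W × ℝ≥0 => ‖lam y p.1‖ₑ ^ 2 := fun y =>
    ((hlam y).comp measurable_fst).enorm.pow_const 2
  have hy : ∀ y : φ ⁻¹' {x}, hatWeightedMeasure ϱ lam ϑ y A =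
      ∫⁻ w, ‖lam y w‖ₑ ^ 2 * ∫⁻ t, (Prod.mk w ⁻¹' A).indicator 1 t ∂(ϑ y w) ∂ϱ := by
    intro y
    rw [hatWeightedMeasure, withDensity_apply _ hA, ← lintegral_indicator hA, hatMeasure,
      Measure.lintegral_compProd ((hm y).indicator hA)]
    refine lintegral_congr fun w => ?_
    have hAw : MeasurableSet (Prod.mk w ⁻¹' A) := measurable_prodMk_left hA
    rw [← lintegral_const_mul _ (measurable_one.indicator hAw)]
    refine lintegral_congr fun t => ?_
    by_cases ht : (w, t) ∈ A <;> simp [ht]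
  simp only [hy]
  rw [← lintegral_tsum fun y => ?_]
  · refine lintegral_congr_ae ?_
    filter_upwards [h] with w hw
    have hAw : MeasurableSet (Prod.mk w ⁻¹' A) := measurable_prodMk_left hA
    rw [← hw x _ (measurable_one.indicator hAw)]
    refine lintegral_congr fun t => ?_
    by_cases ht : (w, t) ∈ A <;> simp [ht]
  · refine (((hlam y).enorm.pow_const 2).mul ?_).aemeasurable
    have : ∀ w, ∫⁻ t, (Prod.mk w ⁻¹' A).indicator 1 t ∂(ϑ y w) = ϑ y w (Prod.mk w ⁻¹' A) := fun w =>
      lintegral_indicator_one (measurable_prodMk_left hA)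
    simp only [this]
    exact Kernel.measurable_kernel_prodMk_left hA

lemma measurable_G [Countable X] {h : X → W × ℝ≥0 → ℝ≥0∞} (hh : ∀ y, Measurable (h y)) (x : X) :
    Measurable (G φ h x) :=
  Measurable.tsum fun y : φ ⁻¹' {x} => hh y

/-- Whatever the versions of the derivatives, `G_x (w, t) = t` almost everywhere. -/
lemma IsDerivFamily.G_ae_eq [Countable X] (hlam : ∀ x, Measurable (lam x))
    [∀ x, IsMarkovKernel (ϑ x)] (hϑ : ∀ᵐ w ∂ϱ, FibreIdentity φ lam ϑ w)
    {h : X → W × ℝ≥0 → ℝ≥0∞} (hh : IsDerivFamily ϱ φ lam ϑ h) (x : X) :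
    G φ h x =ᵐ[hatMeasure ϱ ϑ x] fun p => (p.2 : ℝ≥0∞) := by
  have := sigmaFinite_hatMeasure (ϱ := ϱ) (ϑ := ϑ) x
  rw [← withDensity_eq_iff_of_sigmaFinite (measurable_G (fun y => (hh y).1) x).aemeasurable
    (by fun_prop), withDensity_hatMeasure_eq_sum hlam hϑ]
  have e : G φ h x = ∑' y : φ ⁻¹' {x}, h y := by
    funext p
    rw [tsum_apply (Pi.summable.2 fun _ => ENNReal.summable)]
    rfl
  rw [e, withDensity_tsum fun y : φ ⁻¹' {x} => (hh y).1]
  congr 1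
  funext y
  obtain ⟨y, rfl⟩ := y
  exact (hh y).2.symm

lemma hatWeightedMeasure_absolutelyContinuous [Countable X] (hlam : ∀ x, Measurable (lam x))
    [∀ x, IsMarkovKernel (ϑ x)] (hϑ : ∀ᵐ w ∂ϱ, FibreIdentity φ lam ϑ w) (y : X) :
    hatWeightedMeasure ϱ lam ϑ y ≪ hatMeasure ϱ ϑ (φ y) := by
  refine Measure.AbsolutelyContinuous.trans ?_
    (withDensity_absolutelyContinuous _ fun p : W × ℝ≥0 => (p.2 : ℝ≥0∞))
  rw [withDensity_hatMeasure_eq_sum hlam hϑ]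
  exact (Measure.le_sum (fun z : φ ⁻¹' {φ y} => hatWeightedMeasure ϱ lam ϑ z)
    ⟨y, rfl⟩).absolutelyContinuous

/-- Versions of the derivatives for which `G_x (w, t) = t` everywhere, whenever `x ∈ φ(X)`: on the
null set where the sum of the given versions is wrong, one of them is replaced by `t` and the
others by `0`. -/
lemma exists_isDerivFamily_G_eq [Countable X] (hlam : ∀ x, Measurable (lam x))
    [∀ x, IsMarkovKernel (ϑ x)] (hϑ : ∀ᵐ w ∂ϱ, FibreIdentity φ lam ϑ w) :
    ∃ h, IsDerivFamily ϱ φ lam ϑ h ∧ ∀ y p, G φ h (φ y) p = (p.2 : ℝ≥0∞) := by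
  classical
  let h₀ : X → W × ℝ≥0 → ℝ≥0∞ := fun y =>
    (hatWeightedMeasure ϱ lam ϑ y).rnDeriv (hatMeasure ϱ ϑ (φ y))
  have hh₀ : IsDerivFamily ϱ φ lam ϑ h₀ := fun y => by
    have := sigmaFinite_hatMeasure (ϱ := ϱ) (ϑ := ϑ) (φ y)
    have := sigmaFinite_hatMeasure (ϱ := ϱ) (ϑ := ϑ) y
    have : SFinite (hatWeightedMeasure ϱ lam ϑ y) := by
      rw [hatWeightedMeasure]; infer_instance
    exact ⟨Measure.measurable_rnDeriv _ _, (Measure.withDensity_rnDeriv_eq _ _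
      (hatWeightedMeasure_absolutelyContinuous hlam hϑ y)).symm⟩
  let B : X → Set (W × ℝ≥0) := fun x => {p | G φ h₀ x p ≠ (p.2 : ℝ≥0∞)}
  have hB : ∀ x, MeasurableSet (B x) := fun x =>
    (measurableSet_eq_fun (measurable_G (fun y => (hh₀ y).1) x) (by fun_prop)).compl
  have hB0 : ∀ x, ∀ᵐ p ∂(hatMeasure ϱ ϑ x), p ∉ B x := fun x => by
    filter_upwards [hh₀.G_ae_eq hlam hϑ x] with p hp
    simpa [B] using hp
  let r : X → X := fun y => (⟨y, rfl⟩ : ∃ z, φ z = φ y).choose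
  have hr : ∀ y, φ (r y) = φ y := fun y => (⟨y, rfl⟩ : ∃ z, φ z = φ y).choose_spec
  have hr' : ∀ y z, φ y = φ z → r y = r z := by
    intro y z hyz
    simp only [r, hyz]
  let h : X → W × ℝ≥0 → ℝ≥0∞ := fun y =>
    (B (φ y)).piecewise (fun p => if y = r y then (p.2 : ℝ≥0∞) else 0) (h₀ y)
  refine ⟨h, fun y => ⟨?_, ?_⟩, fun y p => ?_⟩
  · refine Measurable.piecewise (hB _) ?_ (hh₀ y).1
    split_ifs <;> fun_prop
  · rw [(hh₀ y).2]
    refine withDensity_congr_ae ?_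
    filter_upwards [hB0 (φ y)] with p hp
    simp [h, hp]
  · have hz : ∀ z : φ ⁻¹' {φ y}, φ z = φ y := fun z => z.2
    by_cases hp : p ∈ B (φ y)
    · rw [G, tsum_eq_single ⟨r y, hr y⟩]
      · have : r y = r (r y) := hr' _ _ (hr y).symm
        simp [h, hr, hp, ← this]
      · intro z hne
        have : (z : X) ≠ r z := by
          rw [hr' z y (hz z)]
          exact fun e => hne (Subtype.ext e)
        simp [h, hz, hp, this]
    · have e : G φ h (φ y) p = G φ h₀ (φ y) p := tsum_congr fun z => by simp [h, hz, hp]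
      rw [e]
      simpa [B] using hp

end Derivatives

end OWCO

theorem mainTheorem2 {X W : Type*} [Countable X] [MeasurableSpace W] (ϱ : Measure W) [SigmaFinite ϱ]
    (φ : X → X) (lam : X → W → ℂ) (hlam : ∀ x, Measurable (lam x))
    (hbdd : OWCO.IsBoundedOp (OWCO.mulWeightedComp ϱ φ lam))
    (hsub : OWCO.IsSubnormalOp (OWCO.mulWeightedComp ϱ φ lam)) :
    ∃ ϑ : X → Kernel W ℝ≥0,
      -- every `ϑ x w` is a probability measure, measurable in `w`
      (∀ x w, IsProbabilityMeasure (ϑ x w)) ∧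
      (∀ x (σ : Set ℝ≥0), MeasurableSet σ → Measurable (fun w => ϑ x w σ)) ∧
      (∀ x w, ‖lam x w‖ₑ ^ 2 • ϑ x w ≪ ϑ (φ x) w) ∧
      -- for suitable versions of the Radon-Nikodym derivatives, `G_x = G_{φ(x)}` a.e.
      (∃ h, OWCO.IsDerivFamily ϱ φ lam ϑ h ∧
        ∀ x, OWCO.G φ h x =ᵐ[OWCO.hatMeasure ϱ ϑ x] OWCO.G φ h (φ x)) ∧
      -- for all versions, `G_x < ∞` and `λ_x G_x = λ_x G_{φ(x)}` a.e.
      (∀ h, OWCO.IsDerivFamily ϱ φ lam ϑ h → ∀ x,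
        (∀ᵐ p ∂(OWCO.hatMeasure ϱ ϑ x), OWCO.G φ h x p < ∞) ∧
        (∀ᵐ p ∂(OWCO.hatMeasure ϱ ϑ x),
          lam x p.1 ≠ 0 → OWCO.G φ h x p = OWCO.G φ h (φ x) p)) := by
  obtain ⟨c, hc, hgood⟩ := OWCO.exists_ae_riesz_orbitWeight ϱ φ lam hlam hbdd hsub
  obtain ⟨ϑ, hϑm, hϑ, hϑae⟩ := OWCO.exists_kernel_fibreIdentity ϱ φ lam hlam hc hgood
  refine ⟨ϑ, fun x w => inferInstance, fun x σ hσ => Kernel.measurable_coe (ϑ x) hσ, fun x w => ?_,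
    ?_, fun h hh x => ⟨?_, ?_⟩⟩
  · rcases hϑ w with h | h
    · rw [h, h]
      exact Measure.smul_absolutelyContinuous
    · exact h.absolutelyContinuous x
  · obtain ⟨h, hh, hG⟩ := OWCO.exists_isDerivFamily_G_eq hlam hϑae
    refine ⟨h, hh, fun x => ?_⟩
    filter_upwards [hh.G_ae_eq hlam hϑae x] with p hp
    rw [hp, hG]
  · filter_upwards [hh.G_ae_eq hlam hϑae x] with p hp
    rw [hp]
    exact ENNReal.coe_lt_top
  · -- the identity `G_{φ(x)} = t` is transferred along `|λ̂_x|² ϱ̂_x ≪ ϱ̂_{φ(x)}`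
    have h1 := (OWCO.hatWeightedMeasure_absolutelyContinuous hlam hϑae x).ae_le
      (hh.G_ae_eq hlam hϑae (φ x))
    rw [OWCO.hatWeightedMeasure] at h1
    have hm : Measurable fun p : W × ℝ≥0 => ‖lam x p.1‖ₑ ^ 2 :=
      ((hlam x).comp measurable_fst).enorm.pow_const 2
    filter_upwards [hh.G_ae_eq hlam hϑae x, (ae_withDensity_iff hm).1 h1] with p hp hp' h0
    rw [hp, hp' (by simpa using h0)]
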